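/- For an even integer $k\ge 4$ and $\tau$ in the upper half plane $\mathbb{H}$, let $$E_k(\tau)=\frac12\sum_{\substack{c,d\in\mathbb{Z}\\ \gcd(c,d)=1}}(c\tau+d)^{-k}$$ be the normalized Eisenstein series of weight $k$ for $\mathrm{SL}_2(\mathbb{Z})$, let $$\mathcal{F}=\{\tau\in\mathbb{H}: |\tau|>1,\ 0<\operatorname{Re}\tau<\tfrac12\}\cup\{\tau\in\mathbb{H}: |\tau|\ge 1,\ -\tfrac12\le\operatorname{Re}\tau\le 0\}$$ be the standard fundamental domain, and let $\mathcal{A}=\{e^{i\theta}:\pi/2\le\theta\le 2\pi/3\}$. Let $k$ be an even integer. 1. If $k\ge 10$, then every zero of $E_k^2(\tau)+E_{2k}(\tau)$ in $\mathcal{F}$ lies on the arc $\mathcal{A}$. 2. If $k\ge 16$, then every zero of $E_k^3(\tau)+E_{3k}(\tau)$ in $\mathcal{F}$ lies on the arc $\mathcal{A}$. -/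

import Mathlib

open UpperHalfPlane

/-- The standard (half-open) fundamental domain for the action of `SL(2, ℤ)` on the upper half
plane `ℍ`: it contains the left boundary line and the left half of the unit arc. -/
def fundDomain : Set ℍ :=
  {τ | (1 < ‖(τ : ℂ)‖ ∧ 0 < τ.re ∧ τ.re < 1 / 2) ∨
       (1 ≤ ‖(τ : ℂ)‖ ∧ -(1 / 2) ≤ τ.re ∧ τ.re ≤ 0)}

/-- The arc `{e^{iθ} : π/2 ≤ θ ≤ 2π/3}`. -/
def arcA : Set ℂ :=
  {z | ∃ θ : ℝ, Real.pi / 2 ≤ θ ∧ θ ≤ 2 * Real.pi / 3 ∧ z = Complex.exp (θ * Complex.I)}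

/-!
On the half-open fundamental domain, a point off the arc satisfies `|τ| > 1` and `|Re τ| ≤ 1/2`, so
it has to be shown that `f = E_k^p + E_{pk}` (`p = 2, 3`) has no zero there. The proof counts zeros
on the arc, but replaces the valence formula by linear algebra and large-weight asymptotics.

*Linear algebra.* Let `J = E₄³ / Δ`. Dividing by `Δ` repeatedly, a form of weight `12n + w`, with
`w < 12` the weight of some `E_b^r`, is `E_b^r Δ^n P(J)` with `deg P ≤ n`
(`exists_eq_E_pow_mul_eval_kleinJ`). For `p = 2` we have `b = 4`, for `p = 3` we have `b = 6`.

*Separation by `J`.* `J` is injective on the arc (`kleinJ_arcPt_ne`), and takes on the arc no value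
that it takes off the arc (`kleinJ_ne_kleinJ_arcPt`). If `J(a) = J(b)`, then `E_{12m} / Δ^m`, a
polynomial in `J`, agrees at `a` and `b` for every `m`. But `E_{12m}(τ) → 1` off the arc, while
`e^{6imθ} E_{12m}(e^{iθ})` is `2 cos(6mθ) + o(1)` for `π/2 ≤ θ < 2π/3` and tends to `3` at
`θ = 2π/3`. These behaviours are incompatible with a ratio `x^m`, as the duplication formula
`(2 cos φ)² = 2 + 2 cos(2φ)` shows, and for two points of the arc they force the cosines to
agree.

*Sign changes.* `e^{ipkθ/2} f(e^{iθ})` is real. With `φ = kθ/2` and `u = (2 cos(θ/2))^{-k}` it is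
`(2 cos φ + u)^p + 2 cos(pφ) + u^p` up to a small explicit error (`norm_arcE_sub_arcMain_le`), and
it has the sign `(-1)^j` at `φ = jπ/p` (`sign_arcPowAdd_two`, `sign_arcPowAdd_three`). There are
`n + 1` such points on the arc, so `f` has `n` zeros between them, whose `J`-values are `n` distinct
roots of `P`, hence all of them (`ne_zero_of_sign_changes`). A zero of `f` off the arc would share
its `J`-value with one of these, or with the zero `e^{2πi/3}` of `E₄` or `i` of `E₆`.
-/

open Filter Topology MatrixGroups

/-! ### Forms of level one as polynomials in `J` -/

/-- The modular function `E₄³ / Δ`, that is, Klein's `j`. -/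
noncomputable def kleinJ (τ : ℍ) : ℂ := ModularForm.E₄ τ ^ 3 / ModularForm.discriminant τ

/-- If the forms of weight `w` are the multiples of `e`, and `e` has constant term one, then a form
of weight `12n + w` is `e Δ ^ n P(J)` with `deg P ≤ n`: subtracting a multiple of `e E₄ ^ (3n)`
makes it cuspidal, and it can then be divided by `Δ`. -/
lemma exists_eq_mul_eval_kleinJ {w : ℕ} (e : ModularForm 𝒮ℒ (w : ℤ))
    (he : (qExpansion 1 e).coeff 0 = 1)
    (hbase : ∀ f : ModularForm 𝒮ℒ (w : ℤ), ∃ c : ℂ, f = c • e) (n : ℕ) :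
    ∀ f : ModularForm 𝒮ℒ ((12 * n + w : ℕ) : ℤ), ∃ P : Polynomial ℂ, P.natDegree ≤ n ∧
      ∀ τ, f τ = e τ * ModularForm.discriminant τ ^ n * P.eval (kleinJ τ) := by
  induction n with
  | zero =>
    intro f
    obtain ⟨c, hc⟩ := hbase (ModularForm.mcast (by simp) f)
    refine ⟨Polynomial.C c, by simp, fun τ ↦ ?_⟩
    have := congrArg (fun g : ModularForm 𝒮ℒ (w : ℤ) ↦ g τ) hc
    simp only [ModularForm.mcast_apply] at this
    rw [this]
    simp [mul_comm]
  | succ n ih =>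
    intro f
    -- `g` has constant term one, so subtracting a multiple of it makes `f` cuspidal
    let g : ModularForm 𝒮ℒ ((12 * (n + 1) + w : ℕ) : ℤ) :=
      ModularForm.mcast (by push_cast; ring) ((ModularForm.E₄.pow (3 * (n + 1))).mul e)
    have hgval : ∀ τ, g τ = ModularForm.E₄ τ ^ (3 * (n + 1)) * e τ := fun τ ↦ by
      change (ModularForm.E₄.pow (3 * (n + 1))) τ * e τ = _
      rw [ModularForm.coe_pow, Pi.pow_apply]
    have hg : (qExpansion 1 g).coeff 0 = 1 := by
      have : qExpansion 1 g = (qExpansion 1 ModularForm.E₄) ^ (3 * (n + 1)) * qExpansion 1 e := by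
        simp only [g, ModularForm.coe_mcast]
        rw [ModularForm.qExpansion_mul one_pos one_mem_strictPeriods_SL,
          ModularForm.qExpansion_pow one_pos one_mem_strictPeriods_SL]
      have h4 := EisensteinSeries.E_qExpansion_coeff_zero (k := 4) (by norm_num) ⟨2, rfl⟩
      simp only [PowerSeries.coeff_zero_eq_constantCoeff] at he h4 ⊢
      rw [this]
      simp [he, h4]
    set c := (qExpansion 1 f).coeff 0
    have hcusp := ModularForm.sub_smul_isCuspForm f g hg
    rw [ModularForm.isCuspForm_iff_coeffZero_eq_zero] at hcusp
    let h := CuspForm.discriminantEquiv (ModularForm.toCuspForm (f - c • g) hcusp)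
    obtain ⟨P, hP, hPe⟩ := ih (ModularForm.mcast (by push_cast; ring) h)
    refine ⟨P + Polynomial.C c * Polynomial.X ^ (n + 1), ?_, fun τ ↦ ?_⟩
    · refine (Polynomial.natDegree_add_le _ _).trans (max_le (by lia) ?_)
      exact Polynomial.natDegree_C_mul_X_pow_le _ _
    · have hΔ := ModularForm.discriminant_ne_zero τ
      have h1 := ModularForm.discriminant_mul_discriminantEquiv_apply
        (ModularForm.toCuspForm (f - c • g) hcusp) τ
      have h2 := hPe τ
      rw [ModularForm.mcast_apply] at h2
      change _ * h τ = _ at h1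
      rw [h2] at h1
      simp only [ModularForm.toCuspForm_apply, sub_apply] at h1
      have h3 : (c • g) τ = c * g τ := rfl
      rw [h3, hgval] at h1
      have h4 : f τ = c * (ModularForm.E₄ τ ^ (3 * (n + 1)) * e τ) +
        ModularForm.discriminant τ * (e τ * ModularForm.discriminant τ ^ n *
          P.eval (kleinJ τ)) := by rw [h1]; ring
      rw [h4]
      simp only [Polynomial.eval_add, Polynomial.eval_mul, Polynomial.eval_C,
        Polynomial.eval_pow, Polynomial.eval_X]
      have h5 : ModularForm.E₄ τ ^ (3 * (n + 1)) =
          ModularForm.discriminant τ ^ (n + 1) * kleinJ τ ^ (n + 1) := by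
        rw [kleinJ, div_pow, mul_div_cancel₀ _ (pow_ne_zero _ hΔ), pow_mul]
      rw [h5]
      ring

lemma exists_eq_smul_of_rank_eq_one {w : ℤ} (e : ModularForm 𝒮ℒ w)
    (he : (qExpansion 1 e).coeff 0 = 1) (hr : Module.rank ℂ (ModularForm 𝒮ℒ w) = 1)
    (f : ModularForm 𝒮ℒ w) : ∃ c : ℂ, f = c • e := by
  have hne : e ≠ 0 := by
    rintro rfl
    rw [FunLike.coe_zero, qExpansion_zero] at he
    simp at he
  obtain ⟨c, hc⟩ := (finrank_eq_one_iff_of_nonzero' e hne).mp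
    (Module.rank_eq_one_iff_finrank_eq_one.mp hr) f
  exact ⟨c, hc.symm⟩

lemma qExpansion_E_pow_coeff_zero {k : ℕ} (hk : 3 ≤ k) (hk2 : Even k) (r : ℕ) :
    (qExpansion 1 ((ModularForm.E hk).pow r)).coeff 0 = 1 := by
  have h := EisensteinSeries.E_qExpansion_coeff_zero hk hk2
  simp only [PowerSeries.coeff_zero_eq_constantCoeff] at h ⊢
  rw [ModularForm.qExpansion_pow one_pos one_mem_strictPeriods_SL, map_pow, h,
    one_pow]

/-- For even `br < 12` other than `2` the forms of weight `br` are the multiples of `E_b ^ r`, so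
that all forms of weight `12n + br` are described by polynomials in `J`. -/
lemma exists_eq_E_pow_mul_eval_kleinJ {b r : ℕ} (hb : 3 ≤ b) (hb2 : Even b)
    (hbr : b * r ≠ 2) (hbr' : b * r < 12) {n : ℕ} {w : ℤ} (hw : w = 12 * n + b * r)
    (f : ModularForm 𝒮ℒ w) : ∃ P : Polynomial ℂ, P.natDegree ≤ n ∧
      ∀ τ, f τ = ModularForm.E hb τ ^ r * ModularForm.discriminant τ ^ n * P.eval (kleinJ τ) := by
  have he := qExpansion_E_pow_coeff_zero hb hb2 r
  let e : ModularForm 𝒮ℒ ((b * r : ℕ) : ℤ) :=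
    ModularForm.mcast (by push_cast; ring) ((ModularForm.E hb).pow r)
  have hr : Module.rank ℂ (ModularForm 𝒮ℒ ((b * r : ℕ) : ℤ)) = 1 := by
    rw [ModularForm.dimension_level_one _ (hb2.mul_right r), if_neg]
    · simp [Nat.div_eq_of_lt hbr']
    · rw [Nat.ModEq, Nat.mod_eq_of_lt hbr']; exact hbr
  obtain ⟨P, hP, h⟩ := exists_eq_mul_eval_kleinJ e he (exists_eq_smul_of_rank_eq_one e he hr) n
    (ModularForm.mcast (by rw [hw]; push_cast; ring) f)
  refine ⟨P, hP, fun τ ↦ ?_⟩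
  simpa [e, ModularForm.mcast_apply, ModularForm.coe_pow] using h τ

/-! ### Eisenstein series on the unit arc -/

/-- The summand `(ca + db)^{-k}` attached to the pair `p = (c, d)`, set to zero when `c, d` are not
coprime. It has two arguments `a, b` because on the unit arc it is natural to use
`a = e^{iθ/2}`, `b = e^{-iθ/2}` in place of `a = e^{iθ}`, `b = 1`. -/
noncomputable def coprimeTerm (k : ℕ) (a b : ℂ) (p : ℤ × ℤ) : ℂ :=
  if IsCoprime p.1 p.2 then ((p.1 * a + p.2 * b) ^ k)⁻¹ else 0

lemma coprimeTerm_eq_indicator (k : ℕ) (τ : ℍ) :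
    (fun v : Fin 2 → ℤ ↦ coprimeTerm k τ 1 (v 0, v 1)) =
      (EisensteinSeries.gammaSet 1 1 0).indicator
        (fun v ↦ EisensteinSeries.eisSummand k v τ) := by
  funext v
  by_cases h : IsCoprime (v 0) (v 1)
  · rw [Set.indicator_of_mem ((EisensteinSeries.mem_gammaSet_one v).2 h)]
    simp [coprimeTerm, h, EisensteinSeries.eisSummand]
  · rw [Set.indicator_of_notMem (fun h' ↦ h ((EisensteinSeries.mem_gammaSet_one v).1 h'))]
    simp [coprimeTerm, h]

lemma summable_norm_coprimeTerm {k : ℕ} (hk : 3 ≤ k) (τ : ℍ) :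
    Summable (fun p ↦ ‖coprimeTerm k τ 1 p‖) := by
  rw [← (finTwoArrowEquiv ℤ).summable_iff]
  refine Summable.of_nonneg_of_le (fun _ ↦ norm_nonneg _) (fun v ↦ ?_)
    (EisensteinSeries.summable_norm_eisSummand (k := k) (by exact_mod_cast hk) τ)
  have := congrFun (coprimeTerm_eq_indicator k τ) v
  change ‖coprimeTerm k τ 1 (v 0, v 1)‖ ≤ _
  rw [this]
  exact norm_indicator_le_norm_self _ _

/-- The normalised Eisenstein series `E_k(τ)` as a function of all `k : ℕ`; for `k < 3` the value is
junk. -/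
noncomputable def eis (k : ℕ) (τ : ℍ) : ℂ := 1 / 2 * ∑' p, coprimeTerm k τ 1 p

lemma E_eq_eis {k : ℕ} (hk : 3 ≤ k) (τ : ℍ) : ModularForm.E hk τ = eis k τ := by
  rw [eis]
  have h1 : ModularForm.E hk τ = 1 / 2 * ∑' x : EisensteinSeries.gammaSet 1 1 0,
    EisensteinSeries.eisSummand k x τ := rfl
  rw [h1, tsum_subtype (EisensteinSeries.gammaSet 1 1 0)
    (fun v ↦ EisensteinSeries.eisSummand k v τ), ← coprimeTerm_eq_indicator,
    ← (finTwoArrowEquiv ℤ).tsum_eq]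
  rfl

/-- The point `e^{iθ}`, for `0 < θ < π`; for other `θ` the value is junk. -/
noncomputable def arcPt (θ : ℝ) : ℍ := ofComplex (Complex.exp (θ * Complex.I))

lemma exp_mul_I_im_pos {θ : ℝ} (h0 : 0 < θ) (h1 : θ < Real.pi) :
    0 < (Complex.exp (θ * Complex.I)).im := by
  rw [Complex.exp_ofReal_mul_I_im]
  exact Real.sin_pos_of_pos_of_lt_pi h0 h1

lemma coe_arcPt {θ : ℝ} (h0 : 0 < θ) (h1 : θ < Real.pi) :
    (arcPt θ : ℂ) = Complex.exp (θ * Complex.I) := by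
  rw [arcPt, ofComplex_apply_of_im_pos (exp_mul_I_im_pos h0 h1)]

/-- The normalisation `e^{ikθ/2} E_k(e^{iθ})` of `E_k` on the arc. -/
noncomputable def arcE (k : ℕ) (θ : ℝ) : ℂ :=
  Complex.exp (k * θ / 2 * Complex.I) * eis k (arcPt θ)

lemma exp_mul_coprimeTerm (k : ℕ) (θ : ℝ) (p : ℤ × ℤ) :
    Complex.exp (k * θ / 2 * Complex.I) * coprimeTerm k (Complex.exp (θ * Complex.I)) 1 p =
      coprimeTerm k (Complex.exp (θ / 2 * Complex.I)) (Complex.exp (-(θ / 2) * Complex.I)) p := by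
  unfold coprimeTerm
  split_ifs with h
  · have h1 : (p.1 * Complex.exp (θ / 2 * Complex.I) + p.2 * Complex.exp (-(θ / 2) * Complex.I)) =
        Complex.exp (-(θ / 2) * Complex.I) * (p.1 * Complex.exp (θ * Complex.I) + p.2 * 1) := by
      have : Complex.exp (θ / 2 * Complex.I) =
        Complex.exp (-(θ / 2) * Complex.I) * Complex.exp (θ * Complex.I) := by
        rw [← Complex.exp_add]; congr 1; ring
      rw [this]; ring
    rw [h1, mul_pow, mul_inv, ← Complex.exp_nat_mul, ← Complex.exp_neg]
    congr 2
    ring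
  · simp

lemma summable_norm_coprimeTerm_arc {k : ℕ} (hk : 3 ≤ k) {θ : ℝ} (h0 : 0 < θ)
    (h1 : θ < Real.pi) : Summable (fun p ↦ ‖coprimeTerm k (Complex.exp (θ / 2 * Complex.I))
      (Complex.exp (-(θ / 2) * Complex.I)) p‖) := by
  have := (summable_norm_coprimeTerm hk (arcPt θ)).mul_left ‖Complex.exp (k * θ / 2 * Complex.I)‖
  refine this.congr fun p ↦ ?_
  rw [← norm_mul, coe_arcPt h0 h1, exp_mul_coprimeTerm]

lemma arcE_eq_tsum (k : ℕ) {θ : ℝ} (h0 : 0 < θ) (h1 : θ < Real.pi) :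
    arcE k θ = 1 / 2 * ∑' p, coprimeTerm k (Complex.exp (θ / 2 * Complex.I))
      (Complex.exp (-(θ / 2) * Complex.I)) p := by
  rw [arcE, eis, mul_left_comm, ← tsum_mul_left, coe_arcPt h0 h1]
  simp_rw [exp_mul_coprimeTerm]

/-- On the arc the summands of `(c, d)` and `(d, c)` are complex conjugates, so that
`e^{ikθ/2} E_k(e^{iθ})` is real. -/
lemma arcE_im (k : ℕ) {θ : ℝ} (h0 : 0 < θ) (h1 : θ < Real.pi) :
    (arcE k θ).im = 0 := by
  rw [← Complex.conj_eq_iff_im, arcE_eq_tsum _ h0 h1, map_mul, Complex.conj_tsum,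
    ← (Equiv.prodComm ℤ ℤ).tsum_eq]
  congr 1
  · simp only [map_div₀, map_one, map_ofNat]
  · refine tsum_congr fun p ↦ ?_
    obtain ⟨c, d⟩ := p
    change (starRingEnd ℂ) (coprimeTerm _ _ _ (d, c)) = _
    by_cases h : IsCoprime c d
    · rw [coprimeTerm, coprimeTerm, if_pos h, if_pos h.symm]
      simp only [map_inv₀, map_pow, map_add, map_mul, map_intCast, ← Complex.exp_conj,
        Complex.conj_I, map_neg, map_div₀, Complex.conj_ofReal, map_ofNat]
      congr 2
      rw [add_comm]
      simp only [mul_neg, neg_mul, neg_neg]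
    · rw [coprimeTerm, coprimeTerm, if_neg h, if_neg (fun h' ↦ h h'.symm), map_zero]

lemma norm_linear_arc_sq (c d x : ℝ) :
    ‖c * Complex.exp (x * Complex.I) + d * Complex.exp (-x * Complex.I)‖ ^ 2 =
      (c - d) ^ 2 + 4 * (c * d) * Real.cos x ^ 2 := by
  rw [← Complex.normSq_eq_norm_sq, Complex.normSq_apply]
  have h2 : Complex.exp (-x * Complex.I) = Complex.exp (((-x : ℝ) : ℂ) * Complex.I) := by simp
  simp only [Complex.add_re, Complex.mul_re, Complex.add_im, Complex.mul_im, Complex.ofReal_re,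
    Complex.ofReal_im, h2, Complex.exp_ofReal_mul_I_re, Complex.exp_ofReal_mul_I_im, Real.cos_neg,
    Real.sin_neg]
  have := Real.sin_sq_add_cos_sq x
  linear_combination (c - d) ^ 2 * this

/-- The six pairs carrying the main terms of `E_k` on the arc. -/
def mainPairs : Finset (ℤ × ℤ) := {(0, 1), (0, -1), (1, 0), (-1, 0), (1, 1), (-1, -1)}

/-- `|c e^{iθ/2} + d e^{-iθ/2}|² = (c - d)² + 4cdC` with `C = cos²(θ/2)`, which lies in `[1/4, 1/2]`
on the arc. -/
lemma quadratic_bounds {c d : ℤ} (hcd : IsCoprime c d) (hm : (c, d) ∉ mainPairs) {C : ℝ}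
    (hC : 1 / 4 ≤ C) (hC' : C ≤ 1 / 2) :
    c ≠ 0 ∧ d ≠ 0 ∧ (2 : ℝ) ≤ ((c : ℝ) - d) ^ 2 + 4 * (c * d) * C ∧
      |(c : ℝ) * d| ≤ ((c : ℝ) - d) ^ 2 + 4 * (c * d) * C := by
  simp only [mainPairs, Finset.mem_insert, Prod.mk.injEq, Finset.mem_singleton, not_or] at hm
  have hc : c ≠ 0 := by
    rintro rfl
    rw [isCoprime_zero_left, Int.isUnit_iff] at hcd
    lia
  have hd : d ≠ 0 := by
    rintro rfl
    rw [isCoprime_zero_right, Int.isUnit_iff] at hcd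
    lia
  have hne : c ≠ d := by
    rintro rfl
    rw [isCoprime_self, Int.isUnit_iff] at hcd
    lia
  refine ⟨hc, hd, ?_⟩
  rcases lt_or_gt_of_ne (mul_ne_zero hc hd) with h | h
  · have h1 : ((c * d : ℤ) : ℝ) ≤ -1 := by exact_mod_cast (by lia : c * d ≤ -1)
    push_cast at h1
    rw [abs_of_neg (by linarith)]
    constructor <;> nlinarith [sq_nonneg ((c : ℝ) + d)]
  · have h1 : (1 : ℝ) ≤ ((c * d : ℤ) : ℝ) := by exact_mod_cast (by lia : 1 ≤ c * d)
    push_cast at h1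
    have h2 : (1 : ℝ) ≤ (((c - d) ^ 2 : ℤ) : ℝ) := by
      have : 0 < (c - d) ^ 2 := by have := sub_ne_zero.2 hne; positivity
      exact_mod_cast this
    push_cast at h2
    rw [abs_of_pos (by linarith)]
    constructor <;> nlinarith

/-- A majorant for the absolute values of the summands outside `mainPairs` in weight `8`: the
general bound `|cd|⁻⁴`, lowered to zero at the main pairs `±(1, 1)` and to `1/16` at `±(1, -1)`.
For `cd = 0` it is zero because of `0⁻¹ = 0`; such pairs are main pairs or not coprime. -/
noncomputable def pairMajorant (p : ℤ × ℤ) : ℝ :=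
  ((p.1 : ℝ) ^ 4)⁻¹ * ((p.2 : ℝ) ^ 4)⁻¹ - ((if p = (1, 1) then 1 else 0) +
    (if p = (-1, -1) then 1 else 0) + (if p = (1, -1) then 15 / 16 else 0) +
    (if p = (-1, 1) then 15 / 16 else 0))

lemma hasSum_int_inv_pow_four :
    HasSum (fun n : ℤ ↦ ((n : ℝ) ^ 4)⁻¹) (2 * (Real.pi ^ 4 / 90)) := by
  have h := hasSum_zeta_four
  have := HasSum.of_nat_of_neg (f := fun n : ℤ ↦ ((n : ℝ) ^ 4)⁻¹) (g := Real.pi ^ 4 / 90)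
    (g' := Real.pi ^ 4 / 90) (by simpa using h)
    (by simpa [Even.neg_pow (show Even 4 by decide)] using h)
  rwa [show Real.pi ^ 4 / 90 + Real.pi ^ 4 / 90 - (((0 : ℤ) : ℝ) ^ 4)⁻¹ =
    2 * (Real.pi ^ 4 / 90) by norm_num; ring] at this

lemma hasSum_pairMajorant :
    HasSum pairMajorant ((2 * (Real.pi ^ 4 / 90)) ^ 2 - (1 + 1 + 15 / 16 + 15 / 16)) := by
  have h := hasSum_int_inv_pow_four
  rw [sq]
  refine HasSum.sub ?_ (((hasSum_ite_eq _ _).add (hasSum_ite_eq _ _)).add (hasSum_ite_eq _ _)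
    |>.add (hasSum_ite_eq _ _))
  exact h.mul h (h.summable.mul_of_nonneg h.summable (fun _ ↦ by positivity)
    (fun _ ↦ by positivity))

lemma pairMajorant_nonneg (p : ℤ × ℤ) : 0 ≤ pairMajorant p := by
  by_cases h1 : p = (1, 1)
  · rw [h1]; norm_num [pairMajorant]
  by_cases h2 : p = (-1, -1)
  · rw [h2]; norm_num [pairMajorant]
  by_cases h3 : p = (1, -1)
  · rw [h3]; norm_num [pairMajorant]
  by_cases h4 : p = (-1, 1)
  · rw [h4]; norm_num [pairMajorant]
  simp only [pairMajorant, if_neg h1, if_neg h2, if_neg h3, if_neg h4, add_zero, sub_zero]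
  positivity

lemma norm_coprimeTerm_le {h : ℕ} (hh : 4 ≤ h) {x : ℝ} (hC : 1 / 4 ≤ Real.cos x ^ 2)
    (hC' : Real.cos x ^ 2 ≤ 1 / 2) (p : ℤ × ℤ) :
    ‖if p ∈ mainPairs then 0 else coprimeTerm (2 * h) (Complex.exp (x * Complex.I))
      (Complex.exp (-x * Complex.I)) p‖ ≤ ((1 / 2) ^ (h - 4)) * pairMajorant p := by
  obtain ⟨c, d⟩ := p
  have hpow : (0 : ℝ) < (1 / 2) ^ (h - 4) := by positivity
  by_cases hm : (c, d) ∈ mainPairs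
  · rw [if_pos hm, norm_zero]
    exact mul_nonneg hpow.le (pairMajorant_nonneg _)
  rw [if_neg hm]
  by_cases hcd : IsCoprime c d
  · obtain ⟨hc, hd, h2, h3⟩ := quadratic_bounds hcd hm hC hC'
    have hq := norm_linear_arc_sq c d x
    set q := ((c : ℝ) - d) ^ 2 + 4 * (c * d) * Real.cos x ^ 2 with hqdef
    have hT : ‖coprimeTerm (2 * h) (Complex.exp (x * Complex.I))
        (Complex.exp (-x * Complex.I)) (c, d)‖ = (q ^ h)⁻¹ := by
      rw [coprimeTerm, if_pos hcd, norm_inv, norm_pow, pow_mul]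
      simp only [Complex.ofReal_intCast] at hq
      rw [hq]
    have hsplit : (q ^ h)⁻¹ ≤ (1 / 2) ^ (h - 4) * (q ^ 4)⁻¹ := by
      have : q ^ h = q ^ (h - 4) * q ^ 4 := by rw [← pow_add]; congr 1; lia
      rw [this, mul_inv, one_div, inv_pow]
      gcongr
    rw [hT]
    refine hsplit.trans (mul_le_mul_of_nonneg_left ?_ hpow.le)
    by_cases hs : (c, d) = (1, -1) ∨ (c, d) = (-1, 1)
    · have : (2 : ℝ) ^ 4 ≤ q ^ 4 := by gcongr
      have h5 : (q ^ 4)⁻¹ ≤ ((2 : ℝ) ^ 4)⁻¹ := by gcongr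
      refine h5.trans ?_
      rcases hs with hs | hs <;> rw [hs] <;> norm_num [pairMajorant]
    · push Not at hs
      have h11 : (c, d) ≠ (1, 1) := by rintro h; rw [h] at hm; exact hm (by decide)
      have h12 : (c, d) ≠ (-1, -1) := by rintro h; rw [h] at hm; exact hm (by decide)
      simp only [pairMajorant, if_neg h11, if_neg h12, if_neg hs.1, if_neg hs.2, add_zero,
        sub_zero]
      rw [← mul_inv, ← mul_pow, ← Even.pow_abs (show Even 4 by decide) ((c : ℝ) * d)]
      have : 0 < |(c : ℝ) * d| := by
        have : (c : ℝ) ≠ 0 := by exact_mod_cast hc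
        have : (d : ℝ) ≠ 0 := by exact_mod_cast hd
        positivity
      gcongr
  · rw [coprimeTerm, if_neg hcd, norm_zero]
    exact mul_nonneg hpow.le (pairMajorant_nonneg _)

/-- The contribution `2cos(kθ/2) + (2cos(θ/2))^{-k}` of `mainPairs` to `e^{ikθ/2} E_k(e^{iθ})`, with
`k = 2h`. -/
noncomputable def arcMain (h : ℕ) (θ : ℝ) : ℝ :=
  2 * Real.cos (h * θ) + ((2 * Real.cos (θ / 2)) ^ (2 * h))⁻¹

lemma sum_mainPairs_coprimeTerm (h : ℕ) (θ : ℝ) :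
    ∑ p ∈ mainPairs, coprimeTerm (2 * h) (Complex.exp (θ / 2 * Complex.I))
      (Complex.exp (-(θ / 2) * Complex.I)) p = 2 * arcMain h θ := by
  have e1 : ((Complex.exp (θ / 2 * Complex.I)) ^ (2 * h))⁻¹ =
      Complex.exp (-(h * θ) * Complex.I) := by
    rw [← Complex.exp_nat_mul, ← Complex.exp_neg]; congr 1; push_cast; ring
  have e2 : ((Complex.exp (-(θ / 2) * Complex.I)) ^ (2 * h))⁻¹ =
      Complex.exp (h * θ * Complex.I) := by
    rw [← Complex.exp_nat_mul, ← Complex.exp_neg]; congr 1; push_cast; ring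
  have ev : Even (2 * h) := even_two_mul h
  have e3 : ((Complex.exp (θ / 2 * Complex.I) + Complex.exp (-(θ / 2) * Complex.I)) ^ (2 * h))⁻¹
      = (((2 * Real.cos (θ / 2)) ^ (2 * h))⁻¹ : ℝ) := by
    push_cast
    rw [Complex.two_cos]
  have e4 : (-Complex.exp (θ / 2 * Complex.I) + -Complex.exp (-(θ / 2) * Complex.I)) ^ (2 * h) =
      (Complex.exp (θ / 2 * Complex.I) + Complex.exp (-(θ / 2) * Complex.I)) ^ (2 * h) := by
    rw [← neg_add, ev.neg_pow]
  simp only [mainPairs]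
  rw [Finset.sum_insert (by decide), Finset.sum_insert (by decide), Finset.sum_insert (by decide),
    Finset.sum_insert (by decide), Finset.sum_insert (by decide), Finset.sum_singleton]
  simp only [coprimeTerm, isCoprime_zero_right, isCoprime_one_right, Int.isUnit_iff,
    IsCoprime.neg_right_iff]
  simp only [Int.cast_zero, Int.cast_one, Int.cast_neg, zero_mul, one_mul, neg_mul, zero_add,
    add_zero, ev.neg_pow, if_true, or_true, true_or]
  simp only [neg_mul] at e1 e2 e3 e4
  rw [e4, e1, e2, e3, arcMain]
  have := Complex.two_cos (h * θ : ℂ)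
  simp only [neg_mul] at this
  push_cast
  linear_combination (-2) * this

lemma cos_half_sq_bounds {θ : ℝ} (h0 : Real.pi / 2 ≤ θ) (h1 : θ ≤ 2 * Real.pi / 3) :
    1 / 4 ≤ Real.cos (θ / 2) ^ 2 ∧ Real.cos (θ / 2) ^ 2 ≤ 1 / 2 := by
  have hp := Real.pi_pos
  have h2 : Real.cos θ ≤ 0 := Real.cos_nonpos_of_pi_div_two_le_of_le h0 (by linarith)
  have h3 : -(1 / 2) ≤ Real.cos θ := by
    have h4 : Real.cos (2 * Real.pi / 3) = -(1 / 2) := by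
      rw [show 2 * Real.pi / 3 = Real.pi - Real.pi / 3 by ring, Real.cos_pi_sub,
        Real.cos_pi_div_three]
    rw [← h4]
    exact Real.cos_le_cos_of_nonneg_of_le_pi (by linarith) (by linarith) h1
  rw [Real.cos_sq, mul_div_cancel₀ _ two_ne_zero]
  constructor <;> linarith

/-- On the arc `E_k` is governed by three pairs of summands. -/
lemma norm_arcE_sub_arcMain_le {h : ℕ} (hh : 4 ≤ h) {θ : ℝ}
    (h0 : Real.pi / 2 ≤ θ) (h1 : θ ≤ 2 * Real.pi / 3) :
    ‖arcE (2 * h) θ - arcMain h θ‖ ≤ 0.41 * (1 / 2) ^ (h - 4) := by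
  have hp := Real.pi_pos
  obtain ⟨hC, hC'⟩ := cos_half_sq_bounds h0 h1
  have hs := (summable_norm_coprimeTerm_arc (k := 2 * h) (by lia) (θ := θ) (by linarith)
    (by linarith)).of_norm
  rw [arcE_eq_tsum _ (by linarith) (by linarith)]
  set T := coprimeTerm (2 * h) (Complex.exp (θ / 2 * Complex.I))
      (Complex.exp (-(θ / 2) * Complex.I)) with hT
  have hsplit : ∑' p, T p = ∑ p ∈ mainPairs, T p + ∑' p, (if p ∈ mainPairs then 0 else T p) := by
    have hfin : HasSum (fun p ↦ if p ∈ mainPairs then T p else 0) (∑ p ∈ mainPairs, T p) := by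
      have := hasSum_sum_of_ne_finset_zero (f := fun p ↦ if p ∈ mainPairs then T p else 0)
        (s := mainPairs) (L := .unconditional _) (fun p hp ↦ if_neg hp)
      rwa [Finset.sum_congr rfl (fun p hp ↦ if_pos hp)] at this
    have := hs.hasSum.sub hfin
    have h2 : (fun p ↦ T p - if p ∈ mainPairs then T p else 0) =
        fun p ↦ if p ∈ mainPairs then 0 else T p := by
      funext p; split_ifs <;> simp
    rw [h2] at this
    rw [this.tsum_eq]; ring
  rw [hsplit, hT, sum_mainPairs_coprimeTerm, ← hT]
  have hb : ‖∑' p, (if p ∈ mainPairs then 0 else T p)‖ ≤ (1 / 2) ^ (h - 4) *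
      ((2 * (Real.pi ^ 4 / 90)) ^ 2 - (1 + 1 + 15 / 16 + 15 / 16)) := by
    refine tsum_of_norm_bounded (hasSum_pairMajorant.mul_left _) fun p ↦ ?_
    have := norm_coprimeTerm_le hh hC hC' p
    push_cast at this
    exact this
  have hpi : (2 * (Real.pi ^ 4 / 90)) ^ 2 - (1 + 1 + 15 / 16 + 15 / 16) ≤ 0.82 := by
    have h3 : Real.pi ^ 4 ≤ 3.1416 ^ 4 := by gcongr; exact Real.pi_lt_d4.le
    have h4 : 2 * (Real.pi ^ 4 / 90) ≤ 2 * (3.1416 ^ 4 / 90) := by gcongr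
    have h5 : (2 * (Real.pi ^ 4 / 90)) ^ 2 ≤ (2 * (3.1416 ^ 4 / 90)) ^ 2 := by gcongr
    refine (sub_le_sub_right h5 _).trans ?_
    norm_num
  rw [show 1 / 2 * (2 * (arcMain h θ : ℂ) + ∑' p, (if p ∈ mainPairs then 0 else T p)) -
    arcMain h θ = 1 / 2 * ∑' p, (if p ∈ mainPairs then 0 else T p) by ring, norm_mul]
  have : (0 : ℝ) < (1 / 2) ^ (h - 4) := by positivity
  norm_num at hb hpi ⊢
  nlinarith

/-! ### Asymptotics for large weight -/

lemma continuousOn_arcE {k : ℕ} (hk : 3 ≤ k) : ContinuousOn (arcE k) (Set.Ioo 0 Real.pi) := by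
  have h1 : (fun θ ↦ eis k (arcPt θ)) = (fun z : ℂ ↦ (ModularForm.E hk ∘ ofComplex) z) ∘
      (fun θ : ℝ ↦ Complex.exp (θ * Complex.I)) := by
    funext θ
    simp [arcPt, ← E_eq_eis hk]
  have h2 : ContinuousOn (fun θ ↦ eis k (arcPt θ)) (Set.Ioo 0 Real.pi) := by
    rw [h1]
    refine (UpperHalfPlane.mdifferentiable_iff.1 (ModularForm.E hk).holo').continuousOn.comp
      (by fun_prop) fun θ hθ ↦ exp_mul_I_im_pos hθ.1 hθ.2
  unfold arcE
  exact ContinuousOn.mul (by fun_prop) h2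

lemma ofReal_arcE_re (k : ℕ) {θ : ℝ} (h0 : 0 < θ) (h1 : θ < Real.pi) :
    ((arcE k θ).re : ℂ) = arcE k θ := by
  rw [← Complex.conj_eq_iff_re]
  exact Complex.conj_eq_iff_im.2 (arcE_im k h0 h1)

lemma norm_linear_sq (c d : ℤ) (τ : ℍ) :
    ‖(c * τ + d : ℂ)‖ ^ 2 = c ^ 2 * ‖(τ : ℂ)‖ ^ 2 + 2 * (c * d) * τ.re + d ^ 2 := by
  rw [← Complex.normSq_eq_norm_sq, ← Complex.normSq_eq_norm_sq, Complex.normSq_apply,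
    Complex.normSq_apply]
  simp only [Complex.add_re, Complex.mul_re, Complex.intCast_re, Complex.intCast_im,
    Complex.add_im, Complex.mul_im, zero_mul, sub_zero, add_zero, coe_re, coe_im]
  ring

lemma one_lt_norm_linear {τ : ℍ} (hτ : 1 < ‖(τ : ℂ)‖) (hre : |τ.re| ≤ 1 / 2) {c : ℤ}
    (hc : c ≠ 0) (d : ℤ) : 1 < ‖(c * τ + d : ℂ)‖ := by
  have h1 : (1 : ℝ) ≤ (c : ℝ) ^ 2 := by
    have : 0 < c ^ 2 := by positivity
    exact_mod_cast this
  have h2 : (1 : ℝ) ≤ (c : ℝ) ^ 2 - |(c : ℝ) * d| + (d : ℝ) ^ 2 := by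
    have : 0 < c ^ 2 - |c * d| + d ^ 2 := by
      have : 0 < c ^ 2 := by positivity
      rcases abs_cases (c * d) with h | h <;>
        nlinarith [sq_nonneg (c - d), sq_nonneg (c + d), sq_nonneg (2 * d - c),
          sq_nonneg (2 * d + c)]
    exact_mod_cast this
  have h3 : -|(c : ℝ) * d| ≤ 2 * (c * d) * τ.re := by
    have := neg_abs_le (2 * ((c : ℝ) * d) * τ.re)
    rw [abs_mul, abs_mul, abs_two] at this
    nlinarith [abs_nonneg ((c : ℝ) * d)]
  have h4 : 1 < ‖(τ : ℂ)‖ ^ 2 := by nlinarith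
  have h5 := norm_linear_sq c d τ
  have h6 : 1 < ‖(c * τ + d : ℂ)‖ ^ 2 := by nlinarith
  by_contra! h
  nlinarith [norm_nonneg (c * τ + d : ℂ)]

/-- Outside the unit circle in the strip `|Re τ| ≤ 1/2`, all summands but those of `(0, ±1)` tend to
zero as the weight grows. -/
lemma tendsto_eis_one {τ : ℍ} (hτ : 1 < ‖(τ : ℂ)‖) (hre : |τ.re| ≤ 1 / 2) :
    Tendsto (fun m ↦ eis (12 * m) τ) atTop (𝓝 1) := by
  have hlim : ∀ p : ℤ × ℤ, Tendsto (fun m ↦ coprimeTerm (12 * m) τ 1 p) atTop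
      (𝓝 (if p ∈ ({(0, 1), (0, -1)} : Finset (ℤ × ℤ)) then 1 else 0)) := by
    rintro ⟨c, d⟩
    by_cases hcop : IsCoprime c d
    · simp only [coprimeTerm, if_pos hcop]
      by_cases hc : c = 0
      · subst hc
        rw [isCoprime_zero_left, Int.isUnit_iff] at hcop
        have : ((0, d) : ℤ × ℤ) ∈ ({(0, 1), (0, -1)} : Finset (ℤ × ℤ)) := by
          rcases hcop with h | h <;> simp [h]
        rw [if_pos this]
        refine tendsto_const_nhds.congr fun m ↦ ?_
        rcases hcop with h | h <;> simp [h, pow_mul, Even.neg_pow (show Even 12 by decide)]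
      · have : ((c, d) : ℤ × ℤ) ∉ ({(0, 1), (0, -1)} : Finset (ℤ × ℤ)) := by simp [hc]
        rw [if_neg this]
        have hn := one_lt_norm_linear hτ hre hc d
        have : ‖((c * τ + d * 1 : ℂ) ^ 12)⁻¹‖ < 1 := by
          rw [mul_one, norm_inv, norm_pow]
          exact inv_lt_one_of_one_lt₀ (one_lt_pow₀ hn (by norm_num))
        refine (tendsto_pow_atTop_nhds_zero_of_norm_lt_one this).congr fun m ↦ ?_
        rw [inv_pow, pow_mul]
    · have : ((c, d) : ℤ × ℤ) ∉ ({(0, 1), (0, -1)} : Finset (ℤ × ℤ)) := by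
        rintro h
        simp only [Finset.mem_insert, Finset.mem_singleton, Prod.mk.injEq] at h
        rcases h with h | h <;> exact hcop (by rw [h.1, h.2]; decide)
      simp [coprimeTerm, hcop, this]
  have hdom : ∀ᶠ m : ℕ in atTop, ∀ p, ‖coprimeTerm (12 * m) τ 1 p‖ ≤ ‖coprimeTerm 12 τ 1 p‖ := by
    filter_upwards [eventually_ge_atTop 1] with m hm
    rintro ⟨c, d⟩
    by_cases hcop : IsCoprime c d
    · simp only [coprimeTerm, if_pos hcop, norm_inv, norm_pow]
      have h1 : 1 ≤ ‖(c * τ + d * 1 : ℂ)‖ := by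
        rw [mul_one]
        by_cases hc : c = 0
        · subst hc
          rw [isCoprime_zero_left, Int.isUnit_iff] at hcop
          rcases hcop with h | h <;> simp [h]
        · exact (one_lt_norm_linear hτ hre hc d).le
      have : ‖(c * τ + d * 1 : ℂ)‖ ^ 12 ≤ ‖(c * τ + d * 1 : ℂ)‖ ^ (12 * m) :=
        pow_le_pow_right₀ h1 (by lia)
      gcongr
    · simp [coprimeTerm, hcop]
  have h := tendsto_tsum_of_dominated_convergence
    (summable_norm_coprimeTerm (k := 12) (by norm_num) τ) hlim hdom
  have hs : ∑' p : ℤ × ℤ,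
      (if p ∈ ({(0, 1), (0, -1)} : Finset (ℤ × ℤ)) then (1 : ℂ) else 0) = 2 := by
    rw [tsum_eq_sum (s := {(0, 1), (0, -1)}) (fun p hp ↦ if_neg hp),
      Finset.sum_congr rfl (fun p hp ↦ if_pos hp)]
    simp
  rw [hs] at h
  have := h.const_mul (1 / 2 : ℂ)
  norm_num at this
  simpa [eis] using this

lemma tendsto_arcE_sub_arcMain {θ : ℝ} (h0 : Real.pi / 2 ≤ θ) (h1 : θ ≤ 2 * Real.pi / 3) :
    Tendsto (fun m ↦ (arcE (12 * m) θ).re - arcMain (6 * m) θ) atTop (𝓝 0) := by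
  have hg : Tendsto (fun m : ℕ ↦ 0.41 * (1 / 2 : ℝ) ^ m) atTop (𝓝 0) := by
    simpa using (tendsto_pow_atTop_nhds_zero_of_lt_one (r := (1 / 2 : ℝ)) (by norm_num)
      (by norm_num)).const_mul 0.41
  refine squeeze_zero_norm' ?_ hg
  filter_upwards [eventually_ge_atTop 1] with m hm
  have h := norm_arcE_sub_arcMain_le (h := 6 * m) (by lia) h0 h1
  rw [show 2 * (6 * m) = 12 * m by ring] at h
  have h2 : (arcE (12 * m) θ).re - arcMain (6 * m) θ =
    (arcE (12 * m) θ - arcMain (6 * m) θ).re := by simp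
  rw [h2, Real.norm_eq_abs]
  refine (Complex.abs_re_le_norm _).trans (h.trans ?_)
  have : (1 / 2 : ℝ) ^ (6 * m - 4) ≤ (1 / 2) ^ m :=
    pow_le_pow_of_le_one (by norm_num) (by norm_num) (by lia)
  linarith

lemma one_le_two_cos_half {θ : ℝ} (h0 : 0 ≤ θ) (h1 : θ ≤ 2 * Real.pi / 3) :
    1 ≤ 2 * Real.cos (θ / 2) := by
  have hp := Real.pi_pos
  have := Real.cos_le_cos_of_nonneg_of_le_pi (x := θ / 2) (y := Real.pi / 3) (by linarith)
    (by linarith) (by linarith)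
  rw [Real.cos_pi_div_three] at this
  linarith

lemma tendsto_arcE_sub_cos {θ : ℝ} (h0 : Real.pi / 2 ≤ θ) (h1 : θ < 2 * Real.pi / 3) :
    Tendsto (fun m : ℕ ↦ (arcE (12 * m) θ).re - 2 * Real.cos (m * (6 * θ))) atTop (𝓝 0) := by
  have hp := Real.pi_pos
  have hc : 1 < 2 * Real.cos (θ / 2) := by
    have := Real.cos_lt_cos_of_nonneg_of_le_pi (x := θ / 2) (y := Real.pi / 3) (by linarith)
      (by linarith) (by linarith)
    rw [Real.cos_pi_div_three] at this
    linarith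
  have hu : Tendsto (fun m : ℕ ↦ (((2 * Real.cos (θ / 2)) ^ 12)⁻¹) ^ m) atTop (𝓝 0) :=
    tendsto_pow_atTop_nhds_zero_of_lt_one (by positivity)
      (inv_lt_one_of_one_lt₀ (one_lt_pow₀ hc (by norm_num)))
  have := (tendsto_arcE_sub_arcMain h0 h1.le).add hu
  rw [add_zero] at this
  refine this.congr fun m ↦ ?_
  rw [arcMain, show 2 * (6 * m) = 12 * m by ring, inv_pow, pow_mul]
  push_cast
  rw [show (6 * (m : ℝ)) * θ = m * (6 * θ) by ring]
  ring

lemma tendsto_arcE_rho :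
    Tendsto (fun m : ℕ ↦ (arcE (12 * m) (2 * Real.pi / 3)).re) atTop (𝓝 3) := by
  have hp := Real.pi_pos
  have := (tendsto_arcE_sub_arcMain (θ := 2 * Real.pi / 3) (by linarith) le_rfl).add_const 3
  rw [zero_add] at this
  refine this.congr fun m ↦ ?_
  have h1 : 2 * Real.cos (2 * Real.pi / 3 / 2) = 1 := by
    rw [show 2 * Real.pi / 3 / 2 = Real.pi / 3 by ring, Real.cos_pi_div_three]; norm_num
  have h2 : Real.cos (((6 * m : ℕ) : ℝ) * (2 * Real.pi / 3)) = 1 := by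
    rw [show ((6 * m : ℕ) : ℝ) * (2 * Real.pi / 3) = ((2 * m : ℕ) : ℝ) * (2 * Real.pi) by
      push_cast; ring, Real.cos_nat_mul_two_pi]
  rw [arcMain, h1, h2]
  norm_num

lemma tendsto_two_mul_atTop : Tendsto (fun m : ℕ ↦ 2 * m) atTop atTop :=
  tendsto_id.const_mul_atTop' (by norm_num)

/-- The duplication formula for the cosine, in the limit of large weight. -/
lemma tendsto_arcE_double {θ : ℝ} (h0 : Real.pi / 2 ≤ θ) (h1 : θ < 2 * Real.pi / 3) :
    Tendsto (fun m : ℕ ↦ (arcE (12 * (2 * m)) θ).re - (arcE (12 * m) θ).re ^ 2) atTop (𝓝 (-2)) := by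
  have h := tendsto_arcE_sub_cos h0 h1
  have hb : Tendsto (fun m : ℕ ↦ ((arcE (12 * m) θ).re - 2 * Real.cos (m * (6 * θ))) *
      (2 * Real.cos (m * (6 * θ)))) atTop (𝓝 0) := by
    refine h.zero_mul_isBoundedUnder_le ⟨2, ?_⟩
    rw [eventually_map]
    refine Eventually.of_forall fun m ↦ ?_
    simp only [Function.comp_apply, Real.norm_eq_abs, abs_mul, abs_two]
    have := Real.abs_cos_le_one (m * (6 * θ))
    linarith
  have h3 := ((h.comp tendsto_two_mul_atTop).sub (h.mul h)).sub ((hb.const_mul 2).add_const 2)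
  norm_num at h3
  refine h3.congr fun m ↦ ?_
  have hc : Real.cos (2 * m * (6 * θ)) = 2 * Real.cos (m * (6 * θ)) ^ 2 - 1 := by
    rw [mul_assoc, Real.cos_two_mul]
  rw [hc]
  ring

lemma isBoundedUnder_arcE {θ : ℝ} (h0 : Real.pi / 2 ≤ θ) (h1 : θ < 2 * Real.pi / 3) :
    IsBoundedUnder (· ≤ ·) atTop (norm ∘ fun m : ℕ ↦ (arcE (12 * m) θ).re) := by
  refine ⟨3, ?_⟩
  have := (tendsto_arcE_sub_cos h0 h1).norm
  rw [norm_zero] at this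
  have h2 := this.eventually_le_const (u := 1) (by norm_num)
  rw [eventually_map]
  filter_upwards [h2] with m hm
  simp only [Function.comp_apply, Real.norm_eq_abs] at hm ⊢
  have h3 := abs_le.1 (Real.abs_cos_le_one (m * (6 * θ)))
  rw [abs_le] at hm ⊢
  constructor <;> linarith [h3.1, h3.2, hm.1, hm.2]

lemma eq_one_of_tendsto_pow {x L : ℝ} (hL : L ≠ 0) (h : Tendsto (fun m : ℕ ↦ x ^ m) atTop (𝓝 L)) :
    x = 1 ∧ L = 1 := by
  have h1 := (tendsto_add_atTop_iff_nat 1).2 h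
  have h2 := h.mul_const x
  have h3 : L = L * x := tendsto_nhds_unique h1 (by simpa [pow_succ] using h2)
  have hx : x = 1 := mul_left_cancel₀ hL (by rw [mul_one]; exact h3.symm)
  refine ⟨hx, ?_⟩
  subst hx
  exact tendsto_nhds_unique h (by simp)

/-- A sequence `cos(mα)` determines `cos α` even up to an error tending to zero. -/
lemma cos_eq_cos_of_tendsto {α β : ℝ}
    (h : Tendsto (fun m : ℕ ↦ Real.cos (m * α) - Real.cos (m * β)) atTop (𝓝 0)) :
    Real.cos α = Real.cos β := by
  by_contra hne
  have h1 := (tendsto_add_atTop_iff_nat 1).2 h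
  have h2 := (tendsto_add_atTop_iff_nat 2).2 h
  -- the recurrence `cos((m+2)α) + cos(mα) = 2 cos α cos((m+1)α)` applied to both sequences
  have h3 := (h2.add h).sub (h1.const_mul (2 * Real.cos β))
  have h4 : Tendsto (fun m : ℕ ↦ Real.cos ((m + 1 : ℕ) * α)) atTop (𝓝 0) := by
    have h5 := h3.const_mul ((2 * (Real.cos α - Real.cos β))⁻¹)
    norm_num at h5
    refine h5.congr fun m ↦ ?_
    have e : ∀ x : ℝ, Real.cos ((m + 2) * x) + Real.cos (m * x) =
        2 * Real.cos x * Real.cos ((m + 1) * x) := fun x ↦ by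
      rw [show (m + 2) * x = (m + 1) * x + x by ring, show m * x = (m + 1) * x - x by ring,
        Real.cos_add, Real.cos_sub]
      ring
    have h6 : Real.cos α - Real.cos β ≠ 0 := sub_ne_zero.2 hne
    have hX : Real.cos ((m + 2) * α) - Real.cos ((m + 2) * β) + (Real.cos (m * α) -
        Real.cos (m * β)) - 2 * Real.cos β * (Real.cos ((m + 1) * α) - Real.cos ((m + 1) * β)) =
        2 * (Real.cos α - Real.cos β) * Real.cos ((m + 1) * α) := by
      linear_combination e α - e β
    push_cast
    rw [hX]
    generalize Real.cos ((m + 1) * α) = C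
    field_simp
  have h7 := (tendsto_add_atTop_iff_nat (f := fun m : ℕ ↦ Real.cos (m * α)) 1).1 h4
  have h8 := h7.comp tendsto_two_mul_atTop
  have h9 := ((h7.mul h7).const_mul 2).sub h8
  norm_num at h9
  have h10 : Tendsto (fun _ : ℕ ↦ (1 : ℝ)) atTop (𝓝 0) := by
    refine h9.congr fun m ↦ ?_
    rw [mul_assoc, Real.cos_two_mul]
    ring
  exact one_ne_zero (tendsto_nhds_unique tendsto_const_nhds h10)

/-! ### Separation of points by `J` -/

/-- If `J` takes the same value at `a` and `b`, then so does every quotient `E_{12m} / Δ^m`, because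
it is a polynomial in `J`. -/
lemma eis_mul_discriminant_pow_eq {a b : ℍ} (hab : kleinJ a = kleinJ b) {m : ℕ} (hm : 1 ≤ m) :
    eis (12 * m) a * ModularForm.discriminant b ^ m =
      eis (12 * m) b * ModularForm.discriminant a ^ m := by
  have hk : 3 ≤ 12 * m := by lia
  obtain ⟨P, -, hP⟩ := exists_eq_E_pow_mul_eval_kleinJ (b := 4) (r := 0) (n := m) (by norm_num)
    ⟨2, rfl⟩ (by norm_num) (by norm_num) (by push_cast; ring) (ModularForm.E hk)
  rw [← E_eq_eis hk, ← E_eq_eis hk, hP, hP, hab]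
  ring

/-- The normalisation `e^{6iθ} Δ(e^{iθ})` of the discriminant on the arc; it is real. -/
noncomputable def arcDelta (θ : ℝ) : ℂ :=
  Complex.exp (6 * θ * Complex.I) * ModularForm.discriminant (arcPt θ)

lemma arcDelta_ne_zero (θ : ℝ) : arcDelta θ ≠ 0 :=
  mul_ne_zero (Complex.exp_ne_zero _) (ModularForm.discriminant_ne_zero _)

lemma arcDelta_eq (θ : ℝ) : arcDelta θ = (arcE 4 θ ^ 3 - arcE 6 θ ^ 2) / 1728 := by
  rw [arcDelta, ModularForm.discriminant_eq_E₄_cube_sub_E₆_sq, E_eq_eis, E_eq_eis, arcE, arcE,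
    mul_pow, mul_pow, ← Complex.exp_nat_mul, ← Complex.exp_nat_mul]
  have h1 : (3 : ℕ) * (((4 : ℕ) : ℂ) * θ / 2 * Complex.I) = 6 * θ * Complex.I := by
    push_cast; ring
  have h2 : (2 : ℕ) * (((6 : ℕ) : ℂ) * θ / 2 * Complex.I) = 6 * θ * Complex.I := by
    push_cast; ring
  rw [h1, h2]
  ring

lemma ofReal_arcDelta_re {θ : ℝ} (h0 : 0 < θ) (h1 : θ < Real.pi) :
    ((arcDelta θ).re : ℂ) = arcDelta θ := by
  have h : arcDelta θ = ((((arcE 4 θ).re ^ 3 - (arcE 6 θ).re ^ 2) / 1728 : ℝ) : ℂ) := by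
    rw [arcDelta_eq]
    push_cast
    rw [ofReal_arcE_re 4 h0 h1, ofReal_arcE_re 6 h0 h1]
  rw [h, Complex.ofReal_re]

lemma arcDelta_re_ne_zero {θ : ℝ} (h0 : 0 < θ) (h1 : θ < Real.pi) : (arcDelta θ).re ≠ 0 := by
  intro h
  apply arcDelta_ne_zero θ
  rw [← ofReal_arcDelta_re h0 h1, h, Complex.ofReal_zero]

lemma arcDelta_re_div_pos {s t : ℝ} (hs : s ∈ Set.Ioo 0 Real.pi) (ht : t ∈ Set.Ioo 0 Real.pi) :
    0 < (arcDelta s).re / (arcDelta t).re := by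
  have hc : ContinuousOn (fun θ ↦ (arcDelta θ).re) (Set.Ioo 0 Real.pi) := by
    refine Complex.continuous_re.comp_continuousOn ?_
    simp_rw [funext arcDelta_eq]
    exact (((continuousOn_arcE (by norm_num)).pow 3).sub
      ((continuousOn_arcE (by norm_num)).pow 2)).div_const _
  have hne : ∀ θ ∈ Set.Ioo 0 Real.pi, (arcDelta θ).re ≠ 0 :=
    fun θ hθ ↦ arcDelta_re_ne_zero hθ.1 hθ.2
  by_contra! hle
  have hlt : (arcDelta s).re * (arcDelta t).re ≤ 0 := by
    have : (arcDelta s).re * (arcDelta t).re =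
        (arcDelta s).re / (arcDelta t).re * (arcDelta t).re ^ 2 := by
      field_simp [hne t ht]
    rw [this]
    exact mul_nonpos_of_nonpos_of_nonneg hle (sq_nonneg _)
  -- a sign change would force a zero of the discriminant
  have hz : (0 : ℝ) ∈ (fun θ ↦ (arcDelta θ).re) '' Set.Ioo 0 Real.pi := by
    rcases le_total (arcDelta s).re 0 with h1 | h1
    · have h2 : 0 ≤ (arcDelta t).re := by
        by_contra! h
        have := mul_pos_of_neg_of_neg (lt_of_le_of_ne h1 (hne s hs)) h
        linarith
      exact isPreconnected_Ioo.intermediate_value hs ht hc ⟨h1, h2⟩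
    · have h2 : (arcDelta t).re ≤ 0 := by
        by_contra! h
        have := mul_pos (lt_of_le_of_ne h1 (hne s hs).symm) h
        linarith
      exact isPreconnected_Ioo.intermediate_value ht hs hc ⟨h2, h1⟩
  obtain ⟨θ, hθ, h⟩ := hz
  exact hne θ hθ h

lemma exp_six_pow (m : ℕ) (θ : ℝ) : Complex.exp (((12 * m : ℕ) : ℂ) * θ / 2 * Complex.I) =
    Complex.exp (6 * θ * Complex.I) ^ m := by
  rw [← Complex.exp_nat_mul]
  congr 1
  push_cast
  ring

lemma arcE_re_eq_pow_mul {s t : ℝ} (hs : s ∈ Set.Ioo 0 Real.pi) (ht : t ∈ Set.Ioo 0 Real.pi)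
    (h : kleinJ (arcPt s) = kleinJ (arcPt t)) {m : ℕ} (hm : 1 ≤ m) :
    (arcE (12 * m) s).re = ((arcDelta s).re / (arcDelta t).re) ^ m * (arcE (12 * m) t).re := by
  have h1 := eis_mul_discriminant_pow_eq h hm
  have h2 : arcE (12 * m) s * arcDelta t ^ m = arcE (12 * m) t * arcDelta s ^ m := by
    simp only [arcE, arcDelta, mul_pow, exp_six_pow]
    linear_combination Complex.exp (6 * s * Complex.I) ^ m *
      Complex.exp (6 * t * Complex.I) ^ m * h1
  rw [← ofReal_arcE_re _ hs.1 hs.2, ← ofReal_arcE_re _ ht.1 ht.2, ← ofReal_arcDelta_re hs.1 hs.2,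
    ← ofReal_arcDelta_re ht.1 ht.2] at h2
  have h3 : (arcE (12 * m) s).re * (arcDelta t).re ^ m =
    (arcE (12 * m) t).re * (arcDelta s).re ^ m := by exact_mod_cast h2
  have := arcDelta_re_ne_zero ht.1 ht.2
  rw [div_pow]
  field_simp
  linear_combination h3

lemma mem_Ioo_of_mem_arc {θ : ℝ} (h0 : Real.pi / 2 ≤ θ) (h1 : θ ≤ 2 * Real.pi / 3) :
    θ ∈ Set.Ioo 0 Real.pi := by
  have := Real.pi_pos
  constructor <;> linarith

lemma kleinJ_arcPt_ne {s t : ℝ} (hs : Real.pi / 2 ≤ s) (hst : s < t) (ht : t ≤ 2 * Real.pi / 3) :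
    kleinJ (arcPt s) ≠ kleinJ (arcPt t) := by
  intro h
  have hp := Real.pi_pos
  have hs' := mem_Ioo_of_mem_arc hs (hst.le.trans ht)
  have ht' := mem_Ioo_of_mem_arc (hs.trans hst.le) ht
  set x := (arcDelta s).re / (arcDelta t).re with hx
  have hxpos : 0 < x := arcDelta_re_div_pos hs' ht'
  have hS := tendsto_arcE_double hs (hst.trans_le ht)
  set S : ℕ → ℝ := fun m ↦ (arcE (12 * m) s).re
  set T : ℕ → ℝ := fun m ↦ (arcE (12 * m) t).re
  have hST : ∀ m, 1 ≤ m → S m = x ^ m * T m := fun m hm ↦ arcE_re_eq_pow_mul hs' ht' h hm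
  have hlim : ∀ L : ℝ, L ≠ 0 → Tendsto (fun m ↦ T (2 * m) - T m ^ 2) atTop (𝓝 L) →
      x ^ 2 = 1 ∧ -2 / L = 1 := by
    intro L hL hT
    have h1 := Tendsto.div hS hT hL
    refine eq_one_of_tendsto_pow (div_ne_zero (by norm_num) hL) (h1.congr' ?_)
    filter_upwards [hT.eventually_ne hL, eventually_ge_atTop 1] with m hm hm1
    simp only [Pi.div_apply]
    change (S (2 * m) - S m ^ 2) / _ = _
    rw [hST m hm1, hST (2 * m) (by lia), div_eq_iff hm, pow_mul, mul_pow, ← pow_mul, ← pow_mul,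
      mul_comm m 2]
    ring
  rcases lt_or_eq_of_le ht with ht2 | rfl
  · obtain ⟨hx2, -⟩ := hlim (-2) (by norm_num) (tendsto_arcE_double (hs.trans hst.le) ht2)
    have hx1 : x = 1 := by nlinarith
    have h1 := (tendsto_arcE_sub_cos (hs.trans hst.le) ht2).sub
      (tendsto_arcE_sub_cos hs (hst.trans_le ht))
    have h2 := h1.const_mul (1 / 2 : ℝ)
    norm_num at h2
    have h3 : Real.cos (6 * s) = Real.cos (6 * t) := by
      refine cos_eq_cos_of_tendsto (h2.congr' ?_)
      filter_upwards [eventually_ge_atTop 1] with m hm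
      have := hST m hm
      rw [hx1, one_pow, one_mul] at this
      simp only [S, T] at this
      rw [this]
      ring
    -- `6s` and `6t` lie in `[3π, 4π]`, where the cosine is injective
    have e : ∀ y : ℝ, Real.cos (6 * y) = Real.cos (4 * Real.pi - 6 * y) := fun y ↦ by
      rw [show 4 * Real.pi - 6 * y = ((2 : ℕ) : ℝ) * (2 * Real.pi) - 6 * y by push_cast; ring,
        Real.cos_nat_mul_two_pi_sub]
    rw [e s, e t] at h3
    have := Real.injOn_cos ⟨by linarith, by linarith⟩ ⟨by linarith, by linarith⟩ h3
    linarith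
  · have hT := tendsto_arcE_rho
    obtain ⟨-, h6⟩ := hlim (3 - 3 ^ 2) (by norm_num)
      ((hT.comp tendsto_two_mul_atTop).sub (hT.pow 2))
    norm_num at h6

lemma kleinJ_ne_kleinJ_arcPt {τ : ℍ} (hτ : 1 < ‖(τ : ℂ)‖) (hre : |τ.re| ≤ 1 / 2) {θ : ℝ}
    (h0 : Real.pi / 2 ≤ θ) (h1 : θ ≤ 2 * Real.pi / 3) : kleinJ τ ≠ kleinJ (arcPt θ) := by
  intro h
  have hθ := mem_Ioo_of_mem_arc h0 h1
  have hp := Real.pi_pos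
  have hE := tendsto_eis_one hτ hre
  set e : ℕ → ℂ := fun m ↦ eis (12 * m) τ
  set S : ℕ → ℂ := fun m ↦ ((arcE (12 * m) θ).re : ℂ)
  set ξ := arcDelta θ / ModularForm.discriminant τ
  have hS : ∀ m, 1 ≤ m → S m = ξ ^ m * e m := by
    intro m hm
    have h2 := eis_mul_discriminant_pow_eq h hm
    have h3 := ModularForm.discriminant_ne_zero τ
    simp only [S, e, ξ]
    rw [ofReal_arcE_re _ hθ.1 hθ.2]
    simp only [arcE, arcDelta, exp_six_pow, div_pow, mul_pow]
    field_simp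
    linear_combination -h2
  rcases lt_or_eq_of_le h1 with h1' | rfl
  · -- `S (2m) - S m ^ 2 = S m ^ 2 (e (2m) / e m ^ 2 - 1)` tends both to `-2` and to zero
    have hS2 : Tendsto (fun m ↦ S (2 * m) - S m ^ 2) atTop (𝓝 (-2)) := by
      have := (Complex.continuous_ofReal.tendsto _).comp (tendsto_arcE_double h0 h1')
      norm_num at this
      refine this.congr fun m ↦ ?_
      simp [S]
    have hz : Tendsto (fun m ↦ e (2 * m) / e m ^ 2 - 1) atTop (𝓝 0) := by
      have := ((hE.comp tendsto_two_mul_atTop).div (hE.pow 2) (by norm_num)).sub_const 1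
      norm_num at this
      exact this
    have hb : IsBoundedUnder (· ≤ ·) atTop (norm ∘ fun m ↦ S m) := by
      have := isBoundedUnder_arcE h0 h1'
      simpa [Function.comp_def, S] using this
    have h5 := (hz.zero_mul_isBoundedUnder_le hb).zero_mul_isBoundedUnder_le hb
    have h6 : Tendsto (fun m ↦ S (2 * m) - S m ^ 2) atTop (𝓝 0) := by
      refine h5.congr' ?_
      filter_upwards [hE.eventually_ne one_ne_zero, eventually_ge_atTop 1] with m hm hm1
      rw [hS m hm1, hS (2 * m) (by lia), pow_mul']
      field_simp
    have := tendsto_nhds_unique hS2 h6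
    norm_num at this
  · have h3 : Tendsto S atTop (𝓝 3) := by
      have := (Complex.continuous_ofReal.tendsto _).comp tendsto_arcE_rho
      simpa [Function.comp_def, S] using this
    have hξ : Tendsto (fun m ↦ ξ ^ m) atTop (𝓝 3) := by
      have := h3.div hE one_ne_zero
      rw [div_one] at this
      refine this.congr' ?_
      filter_upwards [hE.eventually_ne one_ne_zero, eventually_ge_atTop 1] with m hm hm1
      simp only [Pi.div_apply]
      rw [hS m hm1, mul_div_cancel_right₀ _ hm]
    have h9 := hξ.comp tendsto_two_mul_atTop
    have h10 := tendsto_nhds_unique h9 ((hξ.pow 2).congr fun m ↦ by simp [pow_mul'])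
    norm_num at h10

/-! ### Special values and the counting argument -/

lemma arcPt_half_pi : arcPt (Real.pi / 2) = UpperHalfPlane.I := by
  have hp := Real.pi_pos
  apply UpperHalfPlane.ext
  rw [coe_arcPt (by linarith) (by linarith)]
  push_cast
  rw [Complex.exp_pi_div_two_mul_I]

lemma eis_six_I : eis 6 UpperHalfPlane.I = 0 := by
  have h := congrFun ((ModularForm.E (k := 6) (by norm_num)).slash_action_eq' _
    ⟨ModularGroup.S, rfl⟩) UpperHalfPlane.I
  have h3 := SlashInvariantForm.slash_S_apply (ModularForm.E (k := 6) (by norm_num)) 6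
    UpperHalfPlane.I
  have h4 : (⟨(-(UpperHalfPlane.I : ℂ))⁻¹, UpperHalfPlane.I.im_inv_neg_coe_pos⟩ : ℍ) =
      UpperHalfPlane.I := by
    apply UpperHalfPlane.ext
    simp
  have h5 : ModularForm.E (k := 6) (by norm_num) UpperHalfPlane.I =
      ModularForm.E (k := 6) (by norm_num) UpperHalfPlane.I * (Complex.I : ℂ) ^ (-6 : ℤ) := by
    rw [h4] at h3
    exact h.symm.trans h3
  have h6 : (Complex.I : ℂ) ^ (-6 : ℤ) = -1 := by
    rw [zpow_neg, show (6 : ℤ) = ((6 : ℕ) : ℤ) by norm_num, zpow_natCast,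
      show (6 : ℕ) = 2 * 3 by norm_num, pow_mul, Complex.I_sq]
    norm_num
  rw [h6, E_eq_eis] at h5
  linear_combination h5 / 2

/-- The points `ρ = e^{2πi/3}` and `ρ + 1 = e^{πi/3}` carry the same value of `E₄`, but the real
quantities `e^{2iθ} E₄(e^{iθ})` at these points differ by the non-real factor `e^{2πi/3}`. -/
lemma eis_four_rho : eis 4 (arcPt (2 * Real.pi / 3)) = 0 := by
  have hp := Real.pi_pos
  have h1 := SlashInvariantForm.vAdd_apply_of_mem_strictPeriods
    (ModularForm.E (k := 4) (by norm_num)) (arcPt (2 * Real.pi / 3)) one_mem_strictPeriods_SL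
  have hs3 : Real.sin (2 * Real.pi / 3) = √3 / 2 := by
    rw [show 2 * Real.pi / 3 = Real.pi - Real.pi / 3 by ring, Real.sin_pi_sub,
      Real.sin_pi_div_three]
  have hc3 : Real.cos (2 * Real.pi / 3) = -(1 / 2) := by
    rw [show 2 * Real.pi / 3 = Real.pi - Real.pi / 3 by ring, Real.cos_pi_sub,
      Real.cos_pi_div_three]
  have h2 : (1 : ℝ) +ᵥ arcPt (2 * Real.pi / 3) = arcPt (Real.pi / 3) := by
    apply UpperHalfPlane.ext
    rw [coe_vadd, coe_arcPt (by linarith) (by linarith), coe_arcPt (by linarith) (by linarith)]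
    apply Complex.ext
    · rw [Complex.add_re, Complex.exp_ofReal_mul_I_re, Complex.exp_ofReal_mul_I_re, hc3,
        Real.cos_pi_div_three, Complex.ofReal_re]
      norm_num
    · rw [Complex.add_im, Complex.exp_ofReal_mul_I_im, Complex.exp_ofReal_mul_I_im, hs3,
        Real.sin_pi_div_three, Complex.ofReal_im, zero_add]
  rw [h2, E_eq_eis, E_eq_eis] at h1
  have hr1 := arcE_im 4 (θ := 2 * Real.pi / 3) (by linarith) (by linarith)
  have hr2 := arcE_im 4 (θ := Real.pi / 3) (by linarith) (by linarith)
  set a := arcE 4 (Real.pi / 3) with ha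
  have h3 : arcE 4 (2 * Real.pi / 3) = Complex.exp ((2 * Real.pi / 3 : ℝ) * Complex.I) * a := by
    rw [ha, arcE, arcE, h1, ← mul_assoc, ← Complex.exp_add]
    congr 2
    push_cast
    ring
  rw [h3, Complex.mul_im, Complex.exp_ofReal_mul_I_im, hr2, mul_zero, zero_add, hs3] at hr1
  have ha0 : a = 0 := Complex.ext (by simpa using hr1) hr2
  rw [ha, arcE] at ha0
  rw [← h1]
  exact (mul_eq_zero.1 ha0).resolve_left (Complex.exp_ne_zero _)

lemma kleinJ_eq_of_eis_four {τ : ℍ} (h : eis 4 τ = 0) :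
    kleinJ τ = kleinJ (arcPt (2 * Real.pi / 3)) := by
  rw [kleinJ, kleinJ, E_eq_eis, E_eq_eis, h, eis_four_rho]
  simp

lemma kleinJ_eq_of_eis_six {τ : ℍ} (h : eis 6 τ = 0) :
    kleinJ τ = kleinJ (arcPt (Real.pi / 2)) := by
  have key : ∀ z : ℍ, eis 6 z = 0 → kleinJ z = 1728 := by
    intro z hz
    have h1 := ModularForm.discriminant_eq_E₄_cube_sub_E₆_sq z
    have h2 := ModularForm.discriminant_ne_zero z
    have h3 : ModularForm.E₆ z = 0 := by rw [E_eq_eis, hz]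
    rw [h3] at h1
    rw [kleinJ, div_eq_iff h2, h1]
    ring
  rw [key τ h, key _ (arcPt_half_pi ▸ eis_six_I)]

/-- The counting argument: a form of weight `12n + br` with `n` sign changes on the arc is
`E_b^r Δ^n P(J)` with `deg P ≤ n`, and these sign changes already give all roots of `P`. -/
lemma ne_zero_of_sign_changes {b r n : ℕ} (hb : 3 ≤ b) (hb2 : Even b) (hbr : b * r ≠ 2)
    (hbr' : b * r < 12) {w : ℤ} (hw : w = 12 * n + b * r) (f : ModularForm 𝒮ℒ w) {s : ℝ}
    (hs : s = Real.pi / 2 ∨ s = 2 * Real.pi / 3)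
    (hE : ∀ τ, eis b τ = 0 → kleinJ τ = kleinJ (arcPt s)) {G : ℝ → ℝ}
    (hG : ContinuousOn G (Set.Icc (Real.pi / 2) (2 * Real.pi / 3)))
    (hfG : ∀ θ ∈ Set.Icc (Real.pi / 2) (2 * Real.pi / 3), G θ = 0 ↔ f (arcPt θ) = 0)
    {t : ℕ → ℝ} (ht : StrictMono t)
    (htm : ∀ i ≤ n, t i ∈ Set.Icc (Real.pi / 2) (2 * Real.pi / 3)) {j : ℕ}
    (hsign : ∀ i ≤ n, 0 < (-1) ^ (j + i) * G (t i)) {τ : ℍ} (hτ : 1 < ‖(τ : ℂ)‖)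
    (hre : |τ.re| ≤ 1 / 2) : f τ ≠ 0 := by
  have hp := Real.pi_pos
  have hs0 : Real.pi / 2 ≤ s ∧ s ≤ 2 * Real.pi / 3 := by
    rcases hs with rfl | rfl <;> constructor <;> linarith
  obtain ⟨P, hP, hf⟩ := exists_eq_E_pow_mul_eval_kleinJ hb hb2 hbr hbr' hw f
  have hzero : ∀ i : Fin n, ∃ θ ∈ Set.Ioo (t i) (t (i + 1)), G θ = 0 := by
    intro i
    have h1 := hsign i (by lia)
    have h2 := hsign (i + 1) (by lia)
    have hlt := ht (Nat.lt_succ_self i)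
    have hc : ContinuousOn G (Set.Icc (t i) (t (i + 1))) := hG.mono fun x hx ↦
      ⟨(htm i (by lia)).1.trans hx.1, hx.2.trans (htm (i + 1) (by lia)).2⟩
    rw [show j + ((i : ℕ) + 1) = j + i + 1 by ring, pow_succ] at h2
    rcases neg_one_pow_eq_or ℝ (j + i) with h | h <;> rw [h] at h1 h2
    · exact intermediate_value_Ioo' hlt.le hc ⟨by linarith, by linarith⟩
    · exact intermediate_value_Ioo hlt.le hc ⟨by linarith, by linarith⟩
  choose θ hθ hGθ using hzero
  have hθm : ∀ i, Real.pi / 2 < θ i ∧ θ i < 2 * Real.pi / 3 := fun i ↦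
    ⟨(htm i (by lia)).1.trans_lt (hθ i).1, (hθ i).2.trans_le (htm (i + 1) (by lia)).2⟩
  have hinj : Function.Injective (fun i ↦ kleinJ (arcPt (θ i))) := by
    have hmono : ∀ i i' : Fin n, i < i' → kleinJ (arcPt (θ i)) ≠ kleinJ (arcPt (θ i')) := by
      intro i i' hi
      have : t (i + 1) ≤ t i' := ht.monotone (Nat.succ_le_of_lt hi)
      exact kleinJ_arcPt_ne (hθm i).1.le (((hθ i).2.trans_le this).trans (hθ i').1) (hθm i').2.le
    intro i i' h
    rcases lt_trichotomy i i' with hlt | heq | hlt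
    · exact absurd h (hmono _ _ hlt)
    · exact heq
    · exact absurd h.symm (hmono _ _ hlt)
  have hroot : ∀ i, P.eval (kleinJ (arcPt (θ i))) = 0 := by
    intro i
    have h1 := (hfG (θ i) ⟨(hθm i).1.le, (hθm i).2.le⟩).1 (hGθ i)
    rw [hf, E_eq_eis] at h1
    refine (mul_eq_zero.1 h1).resolve_left (mul_ne_zero (pow_ne_zero _ fun h ↦ ?_)
      (pow_ne_zero _ (ModularForm.discriminant_ne_zero _)))
    rcases hs with rfl | rfl
    · exact kleinJ_arcPt_ne le_rfl (hθm i).1 (hθm i).2.le (hE _ h).symm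
    · exact kleinJ_arcPt_ne (hθm i).1.le (hθm i).2 le_rfl (hE _ h)
  intro h0
  rw [hf, E_eq_eis] at h0
  have hJ : P.eval (kleinJ τ) = 0 := by
    refine (mul_eq_zero.1 h0).resolve_left (mul_ne_zero (pow_ne_zero _ fun h ↦ ?_)
      (pow_ne_zero _ (ModularForm.discriminant_ne_zero _)))
    exact kleinJ_ne_kleinJ_arcPt hτ hre hs0.1 hs0.2 (hE _ h)
  have hP0 : P = 0 := by
    refine Polynomial.eq_zero_of_natDegree_lt_card_of_eval_eq_zero' P
      (insert (kleinJ τ) (Finset.univ.image fun i ↦ kleinJ (arcPt (θ i)))) ?_ ?_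
    · intro x hx
      rcases Finset.mem_insert.1 hx with rfl | hx
      · exact hJ
      · obtain ⟨i, -, rfl⟩ := Finset.mem_image.1 hx
        exact hroot i
    · rw [Finset.card_insert_of_notMem, Finset.card_image_of_injective _ hinj, Finset.card_univ,
        Fintype.card_fin]
      · lia
      · intro hx
        obtain ⟨i, -, hi⟩ := Finset.mem_image.1 hx
        exact kleinJ_ne_kleinJ_arcPt hτ hre (hθm i).1.le (hθm i).2.le hi.symm
  -- `P = 0` would make `f` vanish at the sample points
  have h1 := hsign 0 (by lia)
  rw [(hfG (t 0) (htm 0 (by lia))).2 (by rw [hf, hP0]; simp)] at h1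
  simp at h1

/-! ### Signs at the sample points -/

/-- The modular form `E_k^p + E_{pk}`. -/
noncomputable def powAdd {k p : ℕ} (hk : 3 ≤ k) (hpk : 3 ≤ p * k) :
    ModularForm 𝒮ℒ ((p * k : ℕ) : ℤ) :=
  ModularForm.mcast (by push_cast; ring) ((ModularForm.E hk).pow p) + ModularForm.E hpk

lemma powAdd_apply {k p : ℕ} (hk : 3 ≤ k) (hpk : 3 ≤ p * k) (τ : ℍ) :
    powAdd hk hpk τ = eis k τ ^ p + eis (p * k) τ := by
  rw [← E_eq_eis hk, ← E_eq_eis hpk]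
  change (ModularForm.E hk).pow p τ + ModularForm.E hpk τ = _
  rw [ModularForm.coe_pow, Pi.pow_apply]

/-- `e^{ipkθ/2} (E_k^p + E_{pk})(e^{iθ})`, which is real. -/
noncomputable def arcPowAdd (k p : ℕ) (θ : ℝ) : ℝ := (arcE k θ).re ^ p + (arcE (p * k) θ).re

lemma continuousOn_arcPowAdd {k p : ℕ} (hk : 3 ≤ k) (hpk : 3 ≤ p * k) :
    ContinuousOn (arcPowAdd k p) (Set.Icc (Real.pi / 2) (2 * Real.pi / 3)) := by
  have hsub : Set.Icc (Real.pi / 2) (2 * Real.pi / 3) ⊆ Set.Ioo 0 Real.pi :=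
    fun θ hθ ↦ mem_Ioo_of_mem_arc hθ.1 hθ.2
  have h1 := Complex.continuous_re.comp_continuousOn ((continuousOn_arcE hk).mono hsub)
  have h2 := Complex.continuous_re.comp_continuousOn ((continuousOn_arcE hpk).mono hsub)
  exact (h1.pow p).add h2

lemma arcPowAdd_eq_zero_iff {k p : ℕ} (hk : 3 ≤ k) (hpk : 3 ≤ p * k) {θ : ℝ}
    (hθ : θ ∈ Set.Icc (Real.pi / 2) (2 * Real.pi / 3)) :
    arcPowAdd k p θ = 0 ↔ powAdd hk hpk (arcPt θ) = 0 := by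
  obtain ⟨h0, h1⟩ := mem_Ioo_of_mem_arc hθ.1 hθ.2
  have h : ((arcPowAdd k p θ : ℝ) : ℂ) =
      Complex.exp ((p * k : ℕ) * θ / 2 * Complex.I) * powAdd hk hpk (arcPt θ) := by
    rw [arcPowAdd, powAdd_apply]
    push_cast
    rw [ofReal_arcE_re k h0 h1, ofReal_arcE_re (p * k) h0 h1, arcE, arcE, mul_pow,
      ← Complex.exp_nat_mul, mul_add]
    push_cast
    congr 3
    ring
  rw [← Complex.ofReal_eq_zero, h, mul_eq_zero, or_iff_right (Complex.exp_ne_zero _)]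

lemma two_cos_pi_div_three_sub_ge {δ : ℝ} (h0 : 0 < δ) (h1 : δ ≤ Real.pi / 48) :
    1 + 1.69 * δ ≤ 2 * Real.cos (Real.pi / 3 - δ) := by
  have hp := Real.pi_lt_d2
  have hd : δ ≤ 0.0657 := by linarith
  have hc := Real.one_sub_sq_div_two_le_cos (x := δ)
  have hs := Real.sin_gt_sub_cube h0
  have h3 : 1.732 ≤ √3 := Real.le_sqrt_of_sq_le (by norm_num)
  rw [Real.cos_sub, Real.cos_pi_div_three, Real.sin_pi_div_three]
  have hs0 : 0 ≤ δ - δ ^ 3 / 6 := by nlinarith [sq_nonneg δ]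
  have h4 : 1.732 * (δ - δ ^ 3 / 6) ≤ √3 * Real.sin δ := by gcongr
  nlinarith [mul_nonneg h0.le (sub_nonneg.2 hd), mul_nonneg (mul_nonneg h0.le h0.le)
    (sub_nonneg.2 hd)]

lemma one_add_mul_add_sq_le_pow {x : ℝ} (hx : 0 ≤ x) (n : ℕ) :
    1 + n * x + n * (n - 1) / 2 * x ^ 2 ≤ (1 + x) ^ n := by
  induction n with
  | zero => simp
  | succ n ih =>
    rw [pow_succ]
    have h := mul_le_mul_of_nonneg_right ih (by linarith : 0 ≤ 1 + x)
    refine le_trans ?_ h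
    have hn : (0 : ℝ) ≤ n * (n - 1) := by
      rcases n with _ | n
      · simp
      · push_cast; rw [add_sub_cancel_right]; positivity
    have : 0 ≤ (n : ℝ) * (n - 1) / 2 * x ^ 3 := by positivity
    push_cast
    nlinarith

lemma neg_half_le_cos_of_even {j : ℕ} (hj : Even j) : -(1 / 2) ≤ Real.cos (j * Real.pi / 3) := by
  have h := Real.cos_three_mul (j * Real.pi / 3)
  rw [mul_div_cancel₀ _ (by norm_num : (3 : ℝ) ≠ 0), Real.cos_nat_mul_pi, hj.neg_one_pow] at h
  by_contra! hlt
  nlinarith [sq_pos_of_neg (by linarith : 2 * Real.cos (j * Real.pi / 3) + 1 < 0)]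

lemma cos_le_half_of_odd {j : ℕ} (hj : Odd j) : Real.cos (j * Real.pi / 3) ≤ 1 / 2 := by
  have h := Real.cos_three_mul (j * Real.pi / 3)
  rw [mul_div_cancel₀ _ (by norm_num : (3 : ℝ) ≠ 0), Real.cos_nat_mul_pi, hj.neg_one_pow] at h
  by_contra! hlt
  nlinarith [sq_pos_of_pos (by linarith : 0 < 2 * Real.cos (j * Real.pi / 3) - 1)]

lemma abs_arcE_re_sub_arcMain_le {h : ℕ} (hh : 4 ≤ h) {θ : ℝ}
    (h0 : Real.pi / 2 ≤ θ) (h1 : θ ≤ 2 * Real.pi / 3) :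
    |(arcE (2 * h) θ).re - arcMain h θ| ≤ 0.41 * (1 / 2) ^ (h - 4) := by
  have h2 : (arcE (2 * h) θ).re - arcMain h θ = (arcE (2 * h) θ - arcMain h θ).re := by simp
  rw [h2]
  exact (Complex.abs_re_le_norm _).trans (norm_arcE_sub_arcMain_le hh h0 h1)

/-- The value at `θ = jπ/k`, `k = 2h`: the main term `(2 cos(jπ/2) + u)² + 2(-1)^j + u²`, where
`u = (2cos(θ/2))^{-k}`, has sign `(-1)^j`. -/
lemma sign_arcPowAdd_two {h j : ℕ} (hh : 5 ≤ h) (hj : h ≤ j) (hj' : 3 * j ≤ 4 * h) :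
    0 < (-1) ^ j * arcPowAdd (2 * h) 2 (j * Real.pi / (2 * h)) := by
  have hp := Real.pi_pos
  have hh0 : (0 : ℝ) < h := by exact_mod_cast (by lia : 0 < h)
  set θ := j * Real.pi / (2 * h) with hθ
  have h0 : Real.pi / 2 ≤ θ := by
    rw [hθ, div_le_div_iff₀ (by norm_num) (by positivity)]
    have : (h : ℝ) ≤ j := by exact_mod_cast hj
    nlinarith
  have h1 : θ ≤ 2 * Real.pi / 3 := by
    rw [hθ, div_le_div_iff₀ (by positivity) (by norm_num)]
    have : (3 : ℝ) * j ≤ 4 * h := by exact_mod_cast hj'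
    nlinarith
  have e1 : h * θ = j * Real.pi / 2 := by rw [hθ]; field_simp
  have e2 : ((2 * h : ℕ) : ℝ) * θ = j * Real.pi := by rw [hθ]; push_cast; field_simp
  have hr := abs_arcE_re_sub_arcMain_le (h := h) (by lia) h0 h1
  have hr' := abs_arcE_re_sub_arcMain_le (h := 2 * h) (by lia) h0 h1
  have hpow : (1 / 2 : ℝ) ^ (h - 4) ≤ (1 / 2) ^ 1 :=
    pow_le_pow_of_le_one (by norm_num) (by norm_num) (by lia)
  have hpow' : (1 / 2 : ℝ) ^ (2 * h - 4) ≤ (1 / 2) ^ 1 :=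
    pow_le_pow_of_le_one (by norm_num) (by norm_num) (by lia)
  have hcos := one_le_two_cos_half (by linarith) h1
  rw [arcMain, e1] at hr
  rw [arcMain, e2, Real.cos_nat_mul_pi, show 2 * (2 * h) = 2 * h * 2 by ring, pow_mul _ (2 * h),
    ← inv_pow] at hr'
  have hu0 : 0 < ((2 * Real.cos (θ / 2)) ^ (2 * h))⁻¹ := by positivity
  set u := ((2 * Real.cos (θ / 2)) ^ (2 * h))⁻¹ with hu
  rw [arcPowAdd, show 2 * (2 * h) = 2 * h * 2 by ring]
  set x := (arcE (2 * h) θ).re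
  set y := (arcE (2 * h * 2) θ).re
  rw [abs_le] at hr hr'
  rcases Nat.even_or_odd j with hje | hjo
  · rw [hje.neg_one_pow] at hr' ⊢
    nlinarith [sq_nonneg x, sq_nonneg u, hr'.1, hr'.2]
  · rw [hjo.neg_one_pow] at hr' ⊢
    have hc0 : Real.cos (j * Real.pi / 2) = 0 := by
      obtain ⟨m, rfl⟩ := hjo
      rw [Real.cos_eq_zero_iff]
      exact ⟨m, by push_cast; ring⟩
    rw [hc0] at hr
    -- `j` being odd, `θ` keeps the distance `π/(6h)` from `2π/3`, which makes `u` small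
    have hul : u ≤ 0.6 := by
      have hδ : θ / 2 ≤ Real.pi / 3 - Real.pi / (12 * h) := by
        have : (3 : ℝ) * j ≤ 4 * h - 1 := by
          have : 3 * j + 1 ≤ 4 * h := by obtain ⟨m, rfl⟩ := hjo; lia
          have : ((3 * j + 1 : ℕ) : ℝ) ≤ ((4 * h : ℕ) : ℝ) := by exact_mod_cast this
          push_cast at this
          linarith
        rw [hθ, ← sub_nonneg]
        have e : Real.pi / 3 - Real.pi / (12 * h) - j * Real.pi / (2 * h) / 2 =
            Real.pi * (4 * h - 1 - 3 * j) / (12 * h) := by field_simp; ring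
        rw [e]
        exact div_nonneg (mul_nonneg hp.le (by linarith)) (by positivity)
      have hδ2 : Real.pi / (12 * h) ≤ Real.pi / 48 := by
        have : (5 : ℝ) ≤ h := by exact_mod_cast hh
        gcongr
        linarith
      have h3 := two_cos_pi_div_three_sub_ge (by positivity) hδ2
      have h4 : Real.cos (Real.pi / 3 - Real.pi / (12 * h)) ≤ Real.cos (θ / 2) :=
        Real.cos_le_cos_of_nonneg_of_le_pi (by linarith)
          (by have : 0 < Real.pi / (12 * h) := by positivity
              linarith) hδ
      have h5 := one_add_mul_le_pow (a := 1.69 * (Real.pi / (12 * h)))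
        (by have : 0 < Real.pi / (12 * h) := by positivity
            linarith) (2 * h)
      have h6 : ((2 * h : ℕ) : ℝ) * (1.69 * (Real.pi / (12 * h))) = 1.69 * Real.pi / 6 := by
        push_cast; field_simp; norm_num
      have h7 : (1 + 1.69 * (Real.pi / (12 * h))) ^ (2 * h) ≤ (2 * Real.cos (θ / 2)) ^ (2 * h) := by
        have : 0 < Real.pi / (12 * h) := by positivity
        gcongr
        linarith
      have h8 : (5 / 3 : ℝ) ≤ (2 * Real.cos (θ / 2)) ^ (2 * h) := by
        have := Real.pi_gt_three
        linarith
      rw [hu, show (0.6 : ℝ) = (5 / 3)⁻¹ by norm_num]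
      gcongr
    have hx1 : -0.3 ≤ x := by linarith [hr.1]
    have hx2 : x ≤ 0.81 := by linarith [hr.2]
    nlinarith [hr'.1, hr'.2]

/-- The value at `θ = 2jπ/(3k)`, `k = 2h`: the main term `(2 cos(jπ/3) + u)³ + 2(-1)^j + u³`, where
`u = (2cos(θ/2))^{-k}`, has sign `(-1)^j`. -/
lemma sign_arcPowAdd_three {h j : ℕ} (hh : 8 ≤ h) (hj : 3 * h ≤ 2 * j) (hj' : j ≤ 2 * h) :
    0 < (-1) ^ j * arcPowAdd (2 * h) 3 (j * Real.pi / (3 * h)) := by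
  have hp := Real.pi_pos
  have hh0 : (0 : ℝ) < h := by exact_mod_cast (by lia : 0 < h)
  set θ := j * Real.pi / (3 * h) with hθ
  have h0 : Real.pi / 2 ≤ θ := by
    rw [hθ, div_le_div_iff₀ (by norm_num) (by positivity)]
    have : (3 : ℝ) * h ≤ 2 * j := by exact_mod_cast hj
    nlinarith
  have h1 : θ ≤ 2 * Real.pi / 3 := by
    rw [hθ, div_le_div_iff₀ (by positivity) (by norm_num)]
    have : (j : ℝ) ≤ 2 * h := by exact_mod_cast hj'
    nlinarith
  have e1 : h * θ = j * Real.pi / 3 := by rw [hθ]; field_simp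
  have e2 : ((3 * h : ℕ) : ℝ) * θ = j * Real.pi := by rw [hθ]; push_cast; field_simp
  have hr := abs_arcE_re_sub_arcMain_le (h := h) (by lia) h0 h1
  have hr' := abs_arcE_re_sub_arcMain_le (h := 3 * h) (by lia) h0 h1
  have hpow : (1 / 2 : ℝ) ^ (h - 4) ≤ (1 / 2) ^ 4 :=
    pow_le_pow_of_le_one (by norm_num) (by norm_num) (by lia)
  have hpow' : (1 / 2 : ℝ) ^ (3 * h - 4) ≤ (1 / 2) ^ 4 :=
    pow_le_pow_of_le_one (by norm_num) (by norm_num) (by lia)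
  have hcos := one_le_two_cos_half (by linarith) h1
  rw [arcMain, e1] at hr
  rw [arcMain, e2, Real.cos_nat_mul_pi, show 2 * (3 * h) = 2 * h * 3 by ring, pow_mul _ (2 * h),
    ← inv_pow] at hr'
  have hu0 : 0 < ((2 * Real.cos (θ / 2)) ^ (2 * h))⁻¹ := by positivity
  set u := ((2 * Real.cos (θ / 2)) ^ (2 * h))⁻¹ with hu
  rw [arcPowAdd, show 3 * (2 * h) = 2 * h * 3 by ring]
  set x := (arcE (2 * h) θ).re
  set y := (arcE (2 * h * 3) θ).re
  have hu3 : 0 < u ^ 3 := by positivity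
  norm_num at hpow hpow'
  rw [abs_le] at hr hr'
  have hcube : ∀ a b : ℝ, a ≤ b → a ^ 3 ≤ b ^ 3 := fun a b hab ↦ (Odd.pow_le_pow (by decide)).2 hab
  rcases Nat.even_or_odd j with hje | hjo
  · rw [hje.neg_one_pow] at hr' ⊢
    have hc := neg_half_le_cos_of_even hje
    have := hcube (-1.1) x (by linarith [hr.1])
    norm_num at this
    linarith [hr'.1]
  · rw [hjo.neg_one_pow] at hr' ⊢
    have hc := cos_le_half_of_odd hjo
    -- `j` being odd, `θ` keeps the distance `π/(3h)` from `2π/3`, which makes `u` small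
    have hul : u ≤ 0.21 := by
      have hδ : θ / 2 ≤ Real.pi / 3 - Real.pi / (6 * h) := by
        have : (j : ℝ) ≤ 2 * h - 1 := by
          have : j + 1 ≤ 2 * h := by obtain ⟨m, rfl⟩ := hjo; lia
          have : ((j + 1 : ℕ) : ℝ) ≤ ((2 * h : ℕ) : ℝ) := by exact_mod_cast this
          push_cast at this
          linarith
        rw [hθ, ← sub_nonneg]
        have e : Real.pi / 3 - Real.pi / (6 * h) - j * Real.pi / (3 * h) / 2 =
            Real.pi * (2 * h - 1 - j) / (6 * h) := by field_simp; ring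
        rw [e]
        exact div_nonneg (mul_nonneg hp.le (by linarith)) (by positivity)
      have h8 : (8 : ℝ) ≤ h := by exact_mod_cast hh
      have hδ2 : Real.pi / (6 * h) ≤ Real.pi / 48 := by
        gcongr
        linarith
      have hδ0 : 0 < Real.pi / (6 * h) := by positivity
      have h3 := two_cos_pi_div_three_sub_ge hδ0 hδ2
      have h4 : Real.cos (Real.pi / 3 - Real.pi / (6 * h)) ≤ Real.cos (θ / 2) :=
        Real.cos_le_cos_of_nonneg_of_le_pi (by linarith) (by linarith) hδ
      have h5 := one_add_mul_add_sq_le_pow (x := 1.69 * (Real.pi / (6 * h))) (by positivity) h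
      have h6 : (h : ℝ) * (1.69 * (Real.pi / (6 * h))) = 1.69 * Real.pi / 6 := by
        field_simp
      have h7 : (1 + 1.69 * (Real.pi / (6 * h))) ^ h ≤ (2 * Real.cos (θ / 2)) ^ h := by
        gcongr
        linarith
      have h9 : (h : ℝ) * (h - 1) / 2 * (1.69 * (Real.pi / (6 * h))) ^ 2 =
          (1.69 * Real.pi / 6) ^ 2 / 2 * (1 - 1 / h) := by
        field_simp
      have h10 : (1 : ℝ) / h ≤ 1 / 8 := by gcongr
      have h11 : (0.884 : ℝ) ≤ 1.69 * Real.pi / 6 := by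
        have := Real.pi_gt_d2
        linarith
      have h12 : (2.22 : ℝ) ≤ (2 * Real.cos (θ / 2)) ^ h := by
        rw [h6, h9] at h5
        have h13 : (0.884 : ℝ) ^ 2 ≤ (1.69 * Real.pi / 6) ^ 2 := by gcongr
        have h14 : (0.884 : ℝ) ^ 2 / 2 * (1 - 1 / 8) ≤
            (1.69 * Real.pi / 6) ^ 2 / 2 * (1 - 1 / h) := by gcongr
        have h18 := le_trans (by norm_num : (0.341 : ℝ) ≤ 0.884 ^ 2 / 2 * (1 - 1 / 8)) h14
        linarith
      have h15 : (2.22 : ℝ) ^ 2 ≤ (2 * Real.cos (θ / 2)) ^ (2 * h) := by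
        rw [pow_mul']
        gcongr
      rw [hu, inv_le_comm₀ (by positivity) (by norm_num)]
      refine le_trans ?_ h15
      norm_num
    have h16 := hcube x 1.24 (by linarith [hr.2])
    have h17 := hcube u 0.21 hul
    norm_num at h16 h17
    linarith [hr'.2]

lemma one_lt_norm_of_mem_fundDomain {τ : ℍ} (hτ : τ ∈ fundDomain) (ha : (τ : ℂ) ∉ arcA) :
    1 < ‖(τ : ℂ)‖ ∧ |τ.re| ≤ 1 / 2 := by
  rcases hτ with ⟨h1, h2, h3⟩ | ⟨h1, h2, h3⟩
  · exact ⟨h1, abs_le.2 ⟨by linarith, h3.le⟩⟩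
  · refine ⟨lt_of_le_of_ne h1 fun h ↦ ha ?_, abs_le.2 ⟨h2, by linarith⟩⟩
    have hn : τ.re ^ 2 + τ.im ^ 2 = 1 := by
      have := Complex.normSq_eq_norm_sq (τ : ℂ)
      rw [← h, Complex.normSq_apply] at this
      simp only [coe_re, coe_im] at this
      linarith
    refine ⟨Real.arccos τ.re, ?_, ?_, ?_⟩
    · rw [← Real.arccos_zero]
      exact Real.arccos_le_arccos h3
    · have hp := Real.pi_pos
      have hc : Real.arccos (-(1 / 2)) = 2 * Real.pi / 3 := by
        rw [show -(1 / 2 : ℝ) = Real.cos (2 * Real.pi / 3) by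
          rw [show 2 * Real.pi / 3 = Real.pi - Real.pi / 3 by ring, Real.cos_pi_sub,
            Real.cos_pi_div_three]]
        exact Real.arccos_cos (by linarith) (by linarith)
      rw [← hc]
      exact Real.arccos_le_arccos h2
    · apply Complex.ext
      · rw [Complex.exp_ofReal_mul_I_re, Real.cos_arccos (by linarith) (by linarith), coe_re]
      · rw [Complex.exp_ofReal_mul_I_im, Real.sin_arccos, coe_im,
          show 1 - τ.re ^ 2 = τ.im ^ 2 by linarith, Real.sqrt_sq τ.im_pos.le]

lemma strictMono_samples (a : ℕ) {c : ℝ} (hc : 0 < c) :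
    StrictMono fun i : ℕ ↦ ((a + i : ℕ) : ℝ) * Real.pi / c := by
  intro i j hij
  have hp := Real.pi_pos
  have : ((a + i : ℕ) : ℝ) < ((a + j : ℕ) : ℝ) := by exact_mod_cast (by lia : a + i < a + j)
  dsimp only
  gcongr

lemma eis_sq_add_ne_zero {h : ℕ} (hh : 5 ≤ h) {τ : ℍ} (hτ : 1 < ‖(τ : ℂ)‖)
    (hre : |τ.re| ≤ 1 / 2) : eis (2 * h) τ ^ 2 + eis (2 * (2 * h)) τ ≠ 0 := by
  have hp := Real.pi_pos
  have hh0 : (0 : ℝ) < h := by exact_mod_cast (by lia : 0 < h)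
  have hk : 3 ≤ 2 * h := by lia
  have hpk : 3 ≤ 2 * (2 * h) := by lia
  rw [← powAdd_apply hk hpk]
  refine ne_zero_of_sign_changes (b := 4) (r := h % 3) (n := h / 3) (by norm_num) ⟨2, rfl⟩
    (by lia) (by lia) ?_ (powAdd hk hpk) (Or.inr rfl) (fun _ ↦ kleinJ_eq_of_eis_four)
    (continuousOn_arcPowAdd hk hpk) (fun θ hθ ↦ arcPowAdd_eq_zero_iff hk hpk hθ)
    (strictMono_samples h (c := 2 * h) (by positivity)) ?_ (j := h) ?_ hτ hre
  · have : 2 * (2 * h) = 12 * (h / 3) + 4 * (h % 3) := by lia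
    exact_mod_cast this
  · intro i hi
    have h1 : (h : ℝ) ≤ ((h + i : ℕ) : ℝ) := by exact_mod_cast (by lia : h ≤ h + i)
    have h2 : 3 * ((h + i : ℕ) : ℝ) ≤ 4 * h := by exact_mod_cast (by lia : 3 * (h + i) ≤ 4 * h)
    constructor
    · rw [div_le_div_iff₀ (by norm_num) (by positivity)]
      nlinarith
    · rw [div_le_div_iff₀ (by positivity) (by norm_num)]
      nlinarith
  · intro i hi
    exact sign_arcPowAdd_two hh (by lia) (by lia)

lemma eis_cube_add_ne_zero {h : ℕ} (hh : 8 ≤ h) {τ : ℍ} (hτ : 1 < ‖(τ : ℂ)‖)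
    (hre : |τ.re| ≤ 1 / 2) : eis (2 * h) τ ^ 3 + eis (3 * (2 * h)) τ ≠ 0 := by
  have hp := Real.pi_pos
  have hh0 : (0 : ℝ) < h := by exact_mod_cast (by lia : 0 < h)
  have hk : 3 ≤ 2 * h := by lia
  have hpk : 3 ≤ 3 * (2 * h) := by lia
  rw [← powAdd_apply hk hpk]
  refine ne_zero_of_sign_changes (b := 6) (r := h % 2) (n := h / 2) (by norm_num) ⟨3, rfl⟩
    (by lia) (by lia) ?_ (powAdd hk hpk) (Or.inl rfl) (fun _ ↦ kleinJ_eq_of_eis_six)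
    (continuousOn_arcPowAdd hk hpk) (fun θ hθ ↦ arcPowAdd_eq_zero_iff hk hpk hθ)
    (strictMono_samples (2 * h - h / 2) (c := 3 * h) (by positivity)) ?_ (j := 2 * h - h / 2) ?_
    hτ hre
  · have : 3 * (2 * h) = 12 * (h / 2) + 6 * (h % 2) := by lia
    exact_mod_cast this
  · intro i hi
    have h1 : (3 : ℝ) * h ≤ 2 * ((2 * h - h / 2 + i : ℕ) : ℝ) := by
      exact_mod_cast (by lia : 3 * h ≤ 2 * (2 * h - h / 2 + i))
    have h2 : ((2 * h - h / 2 + i : ℕ) : ℝ) ≤ 2 * h := by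
      exact_mod_cast (by lia : 2 * h - h / 2 + i ≤ 2 * h)
    constructor
    · rw [div_le_div_iff₀ (by norm_num) (by positivity)]
      nlinarith
    · rw [div_le_div_iff₀ (by positivity) (by norm_num)]
      nlinarith
  · intro i hi
    exact sign_arcPowAdd_three hh (by lia) (by lia)

/-- `ModularForm.E` is Mathlib's normalised Eisenstein series of level one,
`E_k(τ) = 1/2 ∑_{gcd(c,d)=1} (cτ + d)^{-k}`. -/
theorem theorem1 (k : ℕ) (hk : Even k) :
    (∀ h : 10 ≤ k, ∀ τ ∈ fundDomain,
      (ModularForm.E (k := k) (by omega) τ) ^ 2 + ModularForm.E (k := 2 * k) (by omega) τ = 0 →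
        (τ : ℂ) ∈ arcA) ∧
    (∀ h : 16 ≤ k, ∀ τ ∈ fundDomain,
      (ModularForm.E (k := k) (by omega) τ) ^ 3 + ModularForm.E (k := 3 * k) (by omega) τ = 0 →
        (τ : ℂ) ∈ arcA) := by
  obtain ⟨m, rfl⟩ := even_iff_two_dvd.1 hk
  constructor
  · intro h τ hτ h0
    by_contra ha
    obtain ⟨h1, h2⟩ := one_lt_norm_of_mem_fundDomain hτ ha
    rw [E_eq_eis, E_eq_eis] at h0
    exact eis_sq_add_ne_zero (by lia) h1 h2 h0
  · intro h τ hτ h0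
    by_contra ha
    obtain ⟨h1, h2⟩ := one_lt_norm_of_mem_fundDomain hτ ha
    rw [E_eq_eis, E_eq_eis] at h0
    exact eis_cube_add_ne_zero (by lia) h1 h2 h0
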